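/- Let $L(s)$ be an $L$-function of the following kind. (a) There are an integer $m\ge 1$ (the degree), a number $0\le\vartheta\le 1$ and complex numbers $\alpha_j(p)$ ($p$ prime, $1\le j\le m$) with $|\alpha_j(p)|\le p^{\vartheta}$ such that $$L(s)=\prod_p\prod_{j=1}^m\Big(1-\frac{\alpha_j(p)}{p^s}\Big)^{-1}\qquad(\Re s>1),$$ where the product over $p$ converges absolutely. (b) There are an integer $N_L\ge 1$, complex numbers $\mu_1,\dots,\mu_m$ with $\Re\mu_j>-1$ that are closed under complex conjugation with multiplicity, an integer $0\le r_L\le m$ and a $\kappa\in\mathbb C$ with $|\kappa|=1$ such that $$\xi_L(s)=L(s)\,N_L^{s/2}\prod_{j=1}^m\Gamma_{\mathbb R}(s+\mu_j),\qquad \Gamma_{\mathbb R}(s)=\pi^{-s/2}\Gamma(s/2),$$ extends to a meromorphic function on $\mathbb C$ of order $1$ with no poles except possibly at $s=0$ and $s=1$, each of order exactly $r_L$ (no pole if $r_L=0$), satisfying $\xi_L(s)=\kappa\,\overline{\xi_L(1-\overline s)}$. Moreover $L(s)$ (continued meromorphically) has no pole except possibly at $s=1$, of order $r_L$. The trivial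 zeros of $L(s)$ are those arising from the gamma factors: the points $-2k-\mu_j$ ($1\le j\le m$, $k\ge 0$), listed with multiplicity, except that $r_L$ copies of the point $0$ are removed from the list. All other zeros of $L(s)$, counted with multiplicity, are non-trivial. For real $T$ let $$C_L(T)=N_L\prod_{j=1}^m\big(|iT+\mu_j|+3\big).$$ Then there are absolute constants $X_0$ and $C$ such that for every such $L$ and every real $T$ with $C_L(T)^{1/m}\ge X_0$, the function $L(s)$ has a non-trivial zero $\rho=\beta+i\gamma$ with $$|\gamma-T|\le\frac{\pi}{2}\cdot\frac{1+2\vartheta}{\log\log\log C_L(T)^{1/m}}+\frac{C}{\big(\log\log\log C_L(T)^{1/m}\big)^2}.$$ -/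

import Mathlib

open Filter Asymptotics ComplexConjugate

noncomputable section

/-- The local factor `∏ⱼ (1 - αⱼ p^{-s})⁻¹` at the prime `p` with parameters `α₁, …, αₘ`. -/
def localFactor {m : ℕ} (α : Fin m → ℂ) (p : Nat.Primes) (s : ℂ) : ℂ :=
  ∏ j, (1 - α j / ((p : ℕ) : ℂ) ^ s)⁻¹

/-- `f`, which is holomorphic outside a bounded set, has order of growth `ρ`: the infimum of the
exponents `a ≥ 0` with `f(s) = O(exp(|s|^a))` as `|s| → ∞` is `ρ`.
(Multiplying `f` by a polynomial to clear finitely many poles does not change this infimum.) -/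
def HasGrowthOrder (f : ℂ → ℂ) (ρ : ℝ) : Prop :=
  IsGLB {a : ℝ | 0 ≤ a ∧ f =O[cocompact ℂ] fun s => Real.exp (‖s‖ ^ a)} ρ

/-- `f` is meromorphic at `s₀` and its pole there has order exactly `r`, where `r = 0` means that
`f` has no pole at `s₀`. -/
def HasPoleOrderAt (f : ℂ → ℂ) (s₀ : ℂ) (r : ℕ) : Prop :=
  MeromorphicAt f s₀ ∧ min (meromorphicOrderAt f s₀) 0 = ((-(r : ℤ) : ℤ) : WithTop ℤ)

/-- The class of `L`-functions under consideration. -/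
structure LFunction where
  /-- the degree `m` -/
  degree : ℕ
  degree_pos : 0 < degree
  /-- the exponent `ϑ` in the bound for the local parameters -/
  theta : ℝ
  theta_nonneg : 0 ≤ theta
  theta_le_one : theta ≤ 1
  /-- the local parameters `αⱼ(p)` -/
  localParam : Nat.Primes → Fin degree → ℂ
  norm_localParam_le : ∀ p j, ‖localParam p j‖ ≤ ((p : ℕ) : ℝ) ^ theta
  /-- the function `L(s)`; its value at `s = 1` is meaningless if there is a pole -/
  toFun : ℂ → ℂ
  /-- absolute convergence of the Euler product for `Re s > 1` -/
  euler_summable : ∀ s : ℂ, 1 < s.re →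
    Summable fun p : Nat.Primes => ‖localFactor (localParam p) p s - 1‖
  /-- the Euler product -/
  euler_hasProd : ∀ s : ℂ, 1 < s.re →
    HasProd (fun p : Nat.Primes => localFactor (localParam p) p s) (toFun s)
  /-- the conductor `N_L` -/
  conductor : ℕ
  conductor_pos : 0 < conductor
  /-- the shifts `μⱼ` in the gamma factors -/
  mu : Fin degree → ℂ
  neg_one_lt_re_mu : ∀ j, -1 < (mu j).re
  /-- the family of the `μⱼ` is closed under conjugation, with multiplicity -/
  mu_conj : Finset.univ.val.map mu = Finset.univ.val.map fun j => conj (mu j)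
  /-- the pole order `r_L` -/
  poleOrder : ℕ
  poleOrder_le : poleOrder ≤ degree
  /-- `L(s)` has no pole except possibly at `s = 1` (in particular none at `s = 0`) -/
  analyticAt : ∀ s : ℂ, s ≠ 1 ∨ poleOrder = 0 → AnalyticAt ℂ toFun s
  hasPoleOrderAt_one : HasPoleOrderAt toFun 1 poleOrder
  /-- the meromorphic continuation of the completed `L`-function `ξ_L(s)`;
  its values at `s = 0, 1` are meaningless if there are poles -/
  completed : ℂ → ℂ
  /-- `ξ_L(s) = L(s) N_L^{s/2} ∏ⱼ Γ_ℝ(s + μⱼ)`, where no factor on the right has a pole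
  and away from `s = 0, 1` -/
  completed_eq : ∀ s : ℂ, s ≠ 0 → s ≠ 1 → (∀ j, ∀ k : ℕ, s ≠ -(2 * k) - mu j) →
    completed s = toFun s * (conductor : ℂ) ^ (s / 2) * ∏ j, Complex.Gammaℝ (s + mu j)
  /-- `ξ_L` has no pole except possibly at `s = 0` and `s = 1` -/
  completed_analyticAt : ∀ s : ℂ, (s ≠ 0 ∧ s ≠ 1) ∨ poleOrder = 0 → AnalyticAt ℂ completed s
  completed_hasPoleOrderAt_zero : HasPoleOrderAt completed 0 poleOrder
  completed_hasPoleOrderAt_one : HasPoleOrderAt completed 1 poleOrder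
  /-- `ξ_L` is of order `1` -/
  completed_order : HasGrowthOrder completed 1
  /-- the root number `κ` -/
  rootNumber : ℂ
  norm_rootNumber : ‖rootNumber‖ = 1
  /-- the functional equation -/
  functional_equation : ∀ s : ℂ, s ≠ 0 → s ≠ 1 →
    completed s = rootNumber * conj (completed (1 - conj s))

namespace LFunction

/-- The number of trivial zeros of `L(s)` at the point `ρ`, that is, the multiplicity to which the
gamma factors force `L(s)` to vanish at `ρ`. It is the number of indices `j` such that `ρ` is one
of the poles `-μⱼ, -μⱼ - 2, -μⱼ - 4, …` of `Γ_ℝ(s + μⱼ)`, except that at `ρ = 0` the pole of order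
`r_L` of `ξ_L` absorbs `r_L` of them. -/
def trivialMultiplicity (L : LFunction) (ρ : ℂ) : ℕ :=
  {j : Fin L.degree | ∃ k : ℕ, ρ = -(2 * k) - L.mu j}.ncard - if ρ = 0 then L.poleOrder else 0

/-- `ρ` is a non-trivial zero: a zero of `L(s)`, counted with multiplicity, that is not one of the
trivial zeros. At a point which is not the location of a trivial zero this just says that `L(s)`
vanishes there; at the location of a trivial zero it says that the zero of `L(s)` has larger
multiplicity than the trivial zeros account for. -/
def IsNontrivialZero (L : LFunction) (ρ : ℂ) : Prop :=
  ((L.trivialMultiplicity ρ : ℤ) : WithTop ℤ) < meromorphicOrderAt L.toFun ρ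

/-- The analytic conductor `C_L(T) = N_L ∏ⱼ (|iT + μⱼ| + 3)`. -/
def analyticConductor (L : LFunction) (T : ℝ) : ℝ :=
  L.conductor * ∏ j, (‖Complex.I * T + L.mu j‖ + 3)

/-- `C_L(T)^{1/m}`. -/
def rootAnalyticConductor (L : LFunction) (T : ℝ) : ℝ :=
  L.analyticConductor T ^ (1 / (L.degree : ℝ))

end LFunction

end

open scoped Topology

/-! The functional equation forces `L` to be large to the left of the critical strip, while a
zero-free function on a narrow horizontal strip cannot grow that fast from right to left. Write Λ
for the logarithm of `C_L(T)^{1/m}`. The argument runs on `reduced`, an entire multiple of `ξ_L`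
whose zeros with `Re s > -5` are all non-trivial zeros of `L`.

Suppose there are no non-trivial zeros with `|Im s - T| < δ`. Then `log reduced` is holomorphic
there. Take σR = 1 + ϑ + 2δ and its reflection σL = 1 - σR, and normalise the logarithm to vanish at
σR + iT. Its real part is at most 4mΛ on the relevant rectangle (`exists_norm_reduced_convexity`)
and only O(m log(A/δ)) within δ of σR (`exists_norm_reduced_right_bounds`, from the Euler product).
Mapping the unit disc to the strip by a logarithm and using Borel-Carathéodory and three circles
(`norm_le_of_ne_zero_on_strip`) bounds the logarithm at σL + iT by 16mΛ · (4 log(A/δ)/Λ)^(q/8). Here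
q = exp(-π(σR - σL)/(2δ)) is the distance from the unit circle to the preimage of σL + iT.

On the other hand the functional equation and Gamma quotients give growth at least c^m √C_L(T) from
σR to σL (`exists_reduced_left_lower`), that is, a logarithm of at least m(Λ/2 + log c). This is a
contradiction once q log Λ is at least a constant. As σR - σL = 1 + 2ϑ + 4δ, that condition reads
log log Λ ≥ π(1 + 2ϑ)/(2δ) + O(1), which gives the leading constant π/2. All bounds have the form
(absolute constant)^m times a power of the conductor, so nothing depends on `L` beyond m, ϑ and
`C_L(T)`. -/

/-! ### Lower bounds for Gamma values and their quotients -/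

/-- In Euler's limit formula the factor `n^z n!` has the same modulus at `z` and at `Re z`, so it
cancels in the quotient. Inequalities between Gamma quotients then follow factor by factor. -/
theorem tendsto_prod_norm_Gamma_div {z : ℂ} (hz : 0 < z.re) :
    Tendsto (fun n : ℕ => ∏ j ∈ Finset.range (n + 1), (z.re + j) / ‖z + j‖) atTop
      (𝓝 (‖Complex.Gamma z‖ / Real.Gamma z.re)) := by
  have h := ((Complex.GammaSeq_tendsto_Gamma z).norm).div (Real.GammaSeq_tendsto_Gamma z.re)
    (Real.Gamma_pos_of_pos hz).ne'
  refine h.congr' ?_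
  filter_upwards [eventually_ge_atTop 1] with n hn
  have hn0 : (0 : ℝ) < n := by exact_mod_cast hn
  have hA : (0 : ℝ) < ∏ j ∈ Finset.range (n + 1), (z.re + j) :=
    Finset.prod_pos fun j _ => by positivity
  have hB : (0 : ℝ) < ∏ j ∈ Finset.range (n + 1), ‖z + j‖ := by
    refine Finset.prod_pos fun j _ => norm_pos_iff.2 fun h => ?_
    have := congrArg Complex.re h
    simp at this
    have : (0 : ℝ) ≤ j := Nat.cast_nonneg j
    linarith
  have hf : (0 : ℝ) < n.factorial := by exact_mod_cast n.factorial_pos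
  have hp : (0 : ℝ) < (n : ℝ) ^ z.re := Real.rpow_pos_of_pos hn0 _
  simp only [Pi.div_apply, Complex.GammaSeq, Real.GammaSeq, norm_div, norm_mul, norm_prod,
    Finset.prod_div_distrib]
  have h1 : ‖(n : ℂ) ^ z‖ = (n : ℝ) ^ z.re := by
    simpa using Complex.norm_cpow_eq_rpow_re_of_pos hn0 z
  rw [h1]
  simp only [Complex.norm_natCast]
  field_simp

theorem re_div_norm_mono {z w : ℂ} (hz : 0 < z.re) (hzw : z.re ≤ w.re)
    (him : z.im = w.im) : z.re / ‖z‖ ≤ w.re / ‖w‖ := by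
  have hw : 0 < w.re := hz.trans_le hzw
  have h1 : 0 < ‖z‖ := hz.trans_le (Complex.re_le_norm z)
  have h2 : 0 < ‖w‖ := hw.trans_le (Complex.re_le_norm w)
  rw [div_le_div_iff₀ h1 h2]
  refine abs_le_of_sq_le_sq' ?_ (by positivity) |>.2
  rw [mul_pow, mul_pow, Complex.sq_norm, Complex.sq_norm, Complex.normSq_apply,
    Complex.normSq_apply, him]
  have := mul_le_mul hzw hzw hz.le hw.le
  nlinarith [sq_nonneg w.im, mul_le_mul_of_nonneg_right this (sq_nonneg w.im)]

/-- `‖Γ(x + iy)‖ / Γ(x)` increases with `x`. -/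
theorem norm_Gamma_div_Gamma_re_mono {z w : ℂ} (hz : 0 < z.re) (hzw : z.re ≤ w.re)
    (him : z.im = w.im) :
    ‖Complex.Gamma z‖ / Real.Gamma z.re ≤ ‖Complex.Gamma w‖ / Real.Gamma w.re := by
  refine le_of_tendsto_of_tendsto' (tendsto_prod_norm_Gamma_div hz)
    (tendsto_prod_norm_Gamma_div (hz.trans_le hzw)) fun n => ?_
  refine Finset.prod_le_prod (fun j _ => by positivity) fun j _ => ?_
  have := re_div_norm_mono (z := z + j) (w := w + j)
    (by simp; positivity) (by simpa using hzw) (by simpa using him)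
  simpa using this

theorem re_div_norm_mul_le_sq {z : ℂ} (hz : 0 < z.re) :
    z.re / ‖z‖ * ((z + 1).re / ‖z + 1‖) ≤ ((z + 1 / 2).re / ‖z + 1 / 2‖) ^ 2 := by
  obtain ⟨x, y⟩ := z
  simp only at hz
  set z : ℂ := ⟨x, y⟩
  have h0 : 0 < ‖z‖ := hz.trans_le (Complex.re_le_norm z)
  have h1 : 0 < ‖z + 1‖ := lt_of_lt_of_le (by simp [z]; linarith) (Complex.re_le_norm (z + 1))
  have h2 : 0 < ‖z + 1 / 2‖ :=
    lt_of_lt_of_le (by simp [z]; linarith) (Complex.re_le_norm (z + 1 / 2))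
  refine abs_le_of_sq_le_sq' ?_ (by positivity) |>.2
  rw [mul_pow, div_pow, div_pow, div_pow, Complex.sq_norm, Complex.sq_norm, Complex.sq_norm]
  rw [div_mul_div_comm, div_pow, div_le_div_iff₀]
  · simp only [Complex.normSq_apply, z]
    simp
    have e : (2⁻¹ : ℝ) = 1 / 2 := by norm_num
    rw [e]
    have hy := sq_nonneg y
    -- After squaring and clearing denominators, the difference is a polynomial in `y ^ 2` without
    -- constant term; both coefficients are nonnegative for `x > 0`.
    have key : (x + 1 / 2) ^ 4 * ((x ^ 2 + y ^ 2) * ((x + 1) ^ 2 + y ^ 2)) -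
        x ^ 2 * (x + 1) ^ 2 * ((x + 1 / 2) ^ 2 + y ^ 2) ^ 2 =
        y ^ 2 * ((x + 1 / 2) ^ 4 * (x ^ 2 + (x + 1) ^ 2) - 2 * x ^ 2 * (x + 1) ^ 2 * (x + 1 / 2) ^ 2)
        + y ^ 4 * ((x + 1 / 2) ^ 4 - x ^ 2 * (x + 1) ^ 2) := by ring
    have k1 : 0 ≤ (x + 1 / 2) ^ 4 * (x ^ 2 + (x + 1) ^ 2) -
        2 * x ^ 2 * (x + 1) ^ 2 * (x + 1 / 2) ^ 2 := by
      -- With t = x² + x, the long cofactor is just 3t/2 + 1/4.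
      have : (x + 1 / 2) ^ 4 * (x ^ 2 + (x + 1) ^ 2) - 2 * x ^ 2 * (x + 1) ^ 2 * (x + 1 / 2) ^ 2
        = (x + 1 / 2) ^ 2 * (x ^ 2 + (x ^ 2 + x) + 1 / 4 + x ^ 2 + x * 1 - x ^ 2 + x * (x^2 + x) + (x^2+x) * (x + 1) - (x^2+x) * (2 * x +1) + (x^2 + x) / 2 - x ^ 2 - x ) := by ring
      rw [this]
      have : 0 ≤ x := hz.le
      apply mul_nonneg (by positivity)
      ring_nf
      positivity
    have k2 : 0 ≤ (x + 1 / 2) ^ 4 - x ^ 2 * (x + 1) ^ 2 := by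
      have : (x + 1 / 2) ^ 4 - x ^ 2 * (x + 1) ^ 2 = (x ^ 2 + x) / 2 + 1 / 16 := by ring
      rw [this]; positivity
    nlinarith [mul_nonneg hy k1, mul_nonneg (by positivity : 0 ≤ y ^ 4) k2]
  · have := Complex.normSq_pos.2 (norm_pos_iff.1 h0)
    have := Complex.normSq_pos.2 (norm_pos_iff.1 h1)
    positivity
  · have := Complex.normSq_pos.2 (norm_pos_iff.1 h2)
    positivity

/-- Midpoint log-concavity of `‖Γ(x + iy)‖ / Γ(x)` in `x`. -/
theorem norm_Gamma_div_mul_le_sq {z : ℂ} (hz : 0 < z.re) :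
    ‖Complex.Gamma z‖ / Real.Gamma z.re * (‖Complex.Gamma (z + 1)‖ / Real.Gamma (z + 1).re) ≤
      (‖Complex.Gamma (z + 1 / 2)‖ / Real.Gamma (z + 1 / 2).re) ^ 2 := by
  have h1 : 0 < (z + 1).re := by simp; linarith
  have h2 : 0 < (z + 1 / 2).re := by simp; linarith
  refine le_of_tendsto_of_tendsto'
    ((tendsto_prod_norm_Gamma_div hz).mul (tendsto_prod_norm_Gamma_div h1))
    ((tendsto_prod_norm_Gamma_div h2).pow 2) fun n => ?_
  rw [← Finset.prod_mul_distrib, ← Finset.prod_pow]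
  refine Finset.prod_le_prod (fun j _ => by positivity) fun j _ => ?_
  have := re_div_norm_mul_le_sq (z := z + j) (by simp; positivity)
  have e1 : z + j + 1 = z + 1 + j := by ring
  have e2 : z + j + 1 / 2 = z + 1 / 2 + j := by ring
  rw [e1, e2] at this
  simpa only [Complex.add_re, Complex.natCast_re] using this

/-- By log-convexity of Γ, the slope of log Γ on `[x, x + b]` is at least its slope on `[x - 1, x]`,
which is `log (x - 1)`. -/
theorem rpow_le_Gamma_add_div_Gamma {x b : ℝ} (hx : 1 < x) (hb : 0 < b) :
    (x - 1) ^ b * Real.Gamma x ≤ Real.Gamma (x + b) := by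
  have hx1 : 0 < x - 1 := by linarith
  have hx0 : 0 < x := by linarith
  have hconv := Real.convexOn_log_Gamma.slope_mono_adjacent (x := x - 1) (y := x) (z := x + b)
    (Set.mem_Ioi.2 hx1) (Set.mem_Ioi.2 (by linarith)) (by linarith) (by linarith)
  have hG1 := Real.Gamma_pos_of_pos hx1
  have hGx : Real.Gamma x = (x - 1) * Real.Gamma (x - 1) := by
    have := Real.Gamma_add_one hx1.ne'
    rwa [sub_add_cancel] at this
  have hG := Real.Gamma_pos_of_pos hx0
  have hGb := Real.Gamma_pos_of_pos (show 0 < x + b by linarith)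
  simp only [Function.comp] at hconv
  have e1 : x - (x - 1) = 1 := by ring
  have e2 : x + b - x = b := by ring
  rw [e1, e2, div_one, le_div_iff₀ hb] at hconv
  have e3 : Real.log (Real.Gamma x) - Real.log (Real.Gamma (x - 1)) = Real.log (x - 1) := by
    rw [hGx, Real.log_mul hx1.ne' hG1.ne']; ring
  rw [e3] at hconv
  rw [← Real.log_le_log_iff (mul_pos (Real.rpow_pos_of_pos hx1 _) hG) hGb,
    Real.log_mul (Real.rpow_pos_of_pos hx1 _).ne' hG.ne', Real.log_rpow hx1]
  linarith

/-- A lower bound of Stirling type for quotients of Gamma values. -/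
theorem sqrt_norm_mul_norm_Gamma_le {z : ℂ} {b : ℝ} (hz : 3 / 2 ≤ z.re) (hb : 1 / 2 ≤ b)
    (hb3 : b ≤ 3) :
    1 / 16 * √‖z‖ * ‖Complex.Gamma z‖ ≤ ‖Complex.Gamma (z + b)‖ := by
  have hz0 : 0 < z.re := by linarith
  set x := z.re with hx
  have hG := Real.Gamma_pos_of_pos hz0
  have hGb : 0 < Real.Gamma (x + b) := Real.Gamma_pos_of_pos (by linarith)
  have hzpos : 0 < ‖z‖ := hz0.trans_le (Complex.re_le_norm z)
  -- Since `b ≥ 1/2`, monotonicity reduces `z + b` to `z + 1/2`. Midpoint concavity between `z` and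
  -- `z + 1`, with Γ(z + 1) = zΓ(z), then produces the factor √(‖z‖ / x); the real Gamma quotient
  -- supplies the missing √x.
  have hmono := norm_Gamma_div_Gamma_re_mono (z := z + 1 / 2) (w := z + b) (by simp; linarith)
    (by simp; linarith) (by simp)
  have hconc := norm_Gamma_div_mul_le_sq (z := z) hz0
  have hz1 : z ≠ 0 := norm_pos_iff.1 hzpos
  have e1 : (z + 1).re = x + 1 := by simp [hx]
  have e2 : (z + b).re = x + b := by simp [hx]
  rw [Complex.Gamma_add_one z hz1, e1, Real.Gamma_add_one hz0.ne', norm_mul, ← hx] at hconc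
  rw [e2] at hmono
  set r := ‖Complex.Gamma z‖ / Real.Gamma x with hr
  have hr0 : 0 ≤ r := by positivity
  have hstep : r * √(‖z‖ / x) ≤ ‖Complex.Gamma (z + b)‖ / Real.Gamma (x + b) := by
    refine le_trans ?_ hmono
    refine abs_le_of_sq_le_sq' ?_ (div_nonneg (norm_nonneg _) ?_) |>.2
    · refine le_trans (le_of_eq ?_) hconc
      rw [mul_pow, Real.sq_sqrt (by positivity), hr]
      field_simp
    · exact (Real.Gamma_pos_of_pos (by simp; linarith)).le
  rw [le_div_iff₀ hGb] at hstep
  refine le_trans ?_ hstep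
  have hgr := rpow_le_Gamma_add_div_Gamma (x := x) (b := b) (by linarith) (by linarith)
  have hroot : 1 / 16 * √x ≤ (x - 1) ^ b := by
    have h2 : (1 : ℝ) ≤ 2 * (x - 1) := by linarith
    have h3 : (2 * (x - 1)) ^ (1 / 2 : ℝ) ≤ (2 * (x - 1)) ^ b :=
      Real.rpow_le_rpow_of_exponent_le h2 hb
    rw [← Real.sqrt_eq_rpow, Real.mul_rpow (by norm_num) (by linarith)] at h3
    have h4 : (2 : ℝ) ^ b ≤ 8 := by
      calc (2 : ℝ) ^ b ≤ 2 ^ (3 : ℝ) := Real.rpow_le_rpow_of_exponent_le (by norm_num) hb3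
        _ = 8 := by norm_num
    have h5 : 1 / 2 * √x ≤ √(2 * (x - 1)) := by
      apply Real.le_sqrt_of_sq_le
      rw [mul_pow, Real.sq_sqrt hz0.le]
      linarith
    have h6 : (2 : ℝ) ^ b * (x - 1) ^ b ≤ 8 * (x - 1) ^ b := by
      have : 0 ≤ (x - 1) ^ b := Real.rpow_nonneg (by linarith) _
      gcongr
    linarith
  calc 1 / 16 * √‖z‖ * ‖Complex.Gamma z‖
      = r * √(‖z‖ / x) * ((1 / 16 * √x) * Real.Gamma x) := by
        rw [Real.sqrt_div (norm_nonneg z), hr]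
        have : √x ≠ 0 := (Real.sqrt_pos.2 hz0).ne'
        field_simp
    _ ≤ r * √(‖z‖ / x) * ((x - 1) ^ b * Real.Gamma x) := by gcongr
    _ ≤ r * √(‖z‖ / x) * Real.Gamma (x + b) := by gcongr

theorem norm_sin_le_exp (w : ℂ) : ‖Complex.sin w‖ ≤ Real.exp |w.im| := by
  have h1 : ‖Complex.exp (-w * Complex.I)‖ ≤ Real.exp |w.im| := by
    rw [Complex.norm_exp]; gcongr; simpa using le_abs_self w.im
  have h2 : ‖Complex.exp (w * Complex.I)‖ ≤ Real.exp |w.im| := by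
    rw [Complex.norm_exp]; gcongr; simpa using neg_le_abs w.im
  rw [Complex.sin, norm_div, norm_mul, Complex.norm_I, mul_one]
  have := norm_sub_le (Complex.exp (-w * Complex.I)) (Complex.exp (w * Complex.I))
  simp only [Complex.norm_ofNat]
  linarith

/-- On the line `Re s = 1/2` the reflection formula reads |Γ(s)|² = π / |sin πs|. -/
theorem exp_neg_le_norm_Gamma_half (y : ℝ) :
    Real.exp (-(Real.pi / 2 * |y|)) ≤ ‖Complex.Gamma ⟨1 / 2, y⟩‖ := by
  set s : ℂ := ⟨1 / 2, y⟩ with hs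
  have hc : 1 - s = conj s := by
    apply Complex.ext <;> simp [hs]; norm_num
  have h := Complex.Gamma_mul_Gamma_one_sub s
  rw [hc, Complex.Gamma_conj] at h
  have hG : Complex.Gamma s ≠ 0 := Complex.Gamma_ne_zero_of_re_pos (by simp [hs])
  have h1 := congrArg norm h
  rw [norm_mul, Complex.norm_conj, norm_div, Complex.norm_real, Real.norm_eq_abs,
    abs_of_pos Real.pi_pos] at h1
  have hsin : ‖Complex.sin (Real.pi * s)‖ ≤ Real.exp (Real.pi * |y|) := by
    refine (norm_sin_le_exp _).trans (le_of_eq ?_)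
    simp [hs, abs_mul, abs_of_pos Real.pi_pos]
  have hpos : 0 < ‖Complex.Gamma s‖ := norm_pos_iff.2 hG
  have hsp : 0 < ‖Complex.sin (Real.pi * s)‖ := by
    rcases (norm_nonneg (Complex.sin (Real.pi * s))).eq_or_lt with h0 | h0
    · rw [← h0, div_zero] at h1
      nlinarith
    · exact h0
  refine abs_le_of_sq_le_sq' ?_ hpos.le |>.2
  rw [sq ‖_‖, h1, le_div_iff₀ hsp, ← Real.exp_nat_mul]
  have hpi := Real.pi_gt_three
  calc Real.exp (((2 : ℕ) : ℝ) * -(Real.pi / 2 * |y|)) * ‖Complex.sin (Real.pi * s)‖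
      ≤ Real.exp (((2 : ℕ) : ℝ) * -(Real.pi / 2 * |y|)) * Real.exp (Real.pi * |y|) := by gcongr
    _ = 1 := by rw [← Real.exp_add, Real.exp_eq_one_iff]; push_cast; ring
    _ ≤ Real.pi := by linarith

/-- The bound on `Re z = 1/2` moves to the right by monotonicity in the real part, and Γ has a
positive minimum on the compact real interval. The constant may depend on `R`, as this serves only
as a growth condition for Phragmén-Lindelöf. -/
theorem exists_exp_neg_le_norm_Gamma (R : ℝ) :
    ∃ c > 0, ∀ z : ℂ, 1 / 2 ≤ z.re → z.re ≤ R →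
      c * Real.exp (-(Real.pi / 2 * |z.im|)) ≤ ‖Complex.Gamma z‖ := by
  have hcont : ContinuousOn Real.Gamma (Set.Icc (1 / 2) (max R (1 / 2))) := fun x hx =>
    (Real.differentiableAt_Gamma fun m h => by
      have : (0 : ℝ) ≤ m := Nat.cast_nonneg m
      linarith [hx.1]).continuousAt.continuousWithinAt
  obtain ⟨x₀, hx₀, hmin⟩ := isCompact_Icc.exists_isMinOn (Set.nonempty_Icc.2 (le_max_right R (1/2))) hcont
  have hG0 : 0 < Real.Gamma x₀ := Real.Gamma_pos_of_pos (by linarith [hx₀.1])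
  have hGh : 0 < Real.Gamma (1 / 2) := Real.Gamma_pos_of_pos (by norm_num)
  refine ⟨Real.Gamma x₀ / Real.Gamma (1 / 2), by positivity, fun z hz hzR => ?_⟩
  have h1 := norm_Gamma_div_Gamma_re_mono (z := ⟨1 / 2, z.im⟩) (w := z) (by norm_num) hz rfl
  have h2 := exp_neg_le_norm_Gamma_half z.im
  have h3 : Real.Gamma x₀ ≤ Real.Gamma z.re := hmin ⟨hz, hzR.trans (le_max_left _ _)⟩
  have hGz : 0 < Real.Gamma z.re := hG0.trans_le h3
  rw [le_div_iff₀ hGz] at h1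
  refine le_trans ?_ h1
  calc Real.Gamma x₀ / Real.Gamma (1 / 2) * Real.exp (-(Real.pi / 2 * |z.im|))
      = Real.exp (-(Real.pi / 2 * |z.im|)) / Real.Gamma (1 / 2) * Real.Gamma x₀ := by ring
    _ ≤ _ := by simp only; gcongr

theorem norm_Gammaℝ (s : ℂ) :
    ‖Complex.Gammaℝ s‖ = Real.pi ^ (-s.re / 2) * ‖Complex.Gamma (s / 2)‖ := by
  rw [Complex.Gammaℝ_def, norm_mul, Complex.norm_cpow_eq_rpow_re_of_pos Real.pi_pos]
  congr 2
  simp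

theorem exists_sqrt_norm_mul_norm_Gammaℝ_le :
    ∃ c > 0, ∀ (z : ℂ) (a : ℝ), 3 ≤ z.re → 1 ≤ a → a ≤ 6 →
      c * √‖z‖ * ‖Complex.Gammaℝ z‖ ≤ ‖Complex.Gammaℝ (z + a)‖ := by
  refine ⟨Real.pi ^ (-3 : ℝ) * (1 / 16 * √(1 / 2)), by positivity, fun z a hz ha ha6 => ?_⟩
  have h := sqrt_norm_mul_norm_Gamma_le (z := z / 2) (b := a / 2) (by simp; linarith)
    (by linarith) (by linarith)
  rw [norm_Gammaℝ, norm_Gammaℝ]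
  have e1 : (z + a) / 2 = z / 2 + (a / 2 : ℝ) := by push_cast; ring
  have e2 : ‖z / 2‖ = 1 / 2 * ‖z‖ := by simp; ring
  rw [e2, Real.sqrt_mul (by norm_num)] at h
  rw [e1]
  have e3 : -(z + a).re / 2 = -z.re / 2 + -(a / 2) := by simp; ring
  rw [e3, Real.rpow_add Real.pi_pos]
  have h6 : Real.pi ^ (-3 : ℝ) ≤ Real.pi ^ (-(a / 2)) :=
    Real.rpow_le_rpow_of_exponent_le (by linarith [Real.pi_gt_three]) (by linarith)
  calc Real.pi ^ (-3 : ℝ) * (1 / 16 * √(1 / 2)) * √‖z‖ *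
        (Real.pi ^ (-z.re / 2) * ‖Complex.Gamma (z / 2)‖)
      = Real.pi ^ (-z.re / 2) * Real.pi ^ (-3 : ℝ) *
        (1 / 16 * (√(1 / 2) * √‖z‖) * ‖Complex.Gamma (z / 2)‖) := by ring
    _ ≤ _ := by gcongr

theorem exists_exp_neg_le_norm_Gammaℝ (R : ℝ) :
    ∃ c > 0, ∀ z : ℂ, 1 ≤ z.re → z.re ≤ R →
      c * Real.exp (-(Real.pi / 4 * |z.im|)) ≤ ‖Complex.Gammaℝ z‖ := by
  obtain ⟨c, hc, h⟩ := exists_exp_neg_le_norm_Gamma (R / 2)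
  refine ⟨Real.pi ^ (-R / 2) * c, by positivity, fun z hz hzR => ?_⟩
  have h1 := h (z / 2) (by simp; linarith) (by simp; linarith)
  have e : Real.pi / 2 * |(z / 2).im| = Real.pi / 4 * |z.im| := by
    simp [abs_div]; ring
  rw [e] at h1
  rw [norm_Gammaℝ, mul_assoc]
  have : Real.pi ^ (-R / 2) ≤ Real.pi ^ (-z.re / 2) :=
    Real.rpow_le_rpow_of_exponent_le (by linarith [Real.pi_gt_three]) (by linarith)
  gcongr

/-! ### Three circles and a two-constants theorem on a strip -/

/-- Hadamard's three circles theorem, with explicit radii. -/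
theorem norm_le_rpow_of_three_circles {g : ℂ → ℂ} {q a : ℝ} {x : ℂ} (hq : 0 < q) (hq2 : q ≤ 1 / 2)
    (hg : DifferentiableOn ℂ g (Metric.ball 0 (1 - q / 2)))
    (hg1 : ∀ z ∈ Metric.ball (0 : ℂ) (1 - q / 2), ‖g z‖ ≤ 1)
    (ha : 0 ≤ a) (ha1 : a ≤ 1) (hga : ∀ z : ℂ, ‖z‖ = 1 / 4 → ‖g z‖ ≤ a) (hx : ‖x‖ = 1 - q) :
    ‖g x‖ ≤ a ^ (q / 8) := by
  rcases ha.eq_or_lt with rfl | ha0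
  -- If `a = 0`, the maximum principle kills `g` on the small disc and the identity theorem kills it
  -- everywhere.
  · rw [Real.zero_rpow (by positivity)]
    have hzero : ∀ z ∈ Metric.ball (0 : ℂ) (1 - q / 2), g z = 0 := by
      have hga' : AnalyticOnNhd ℂ g (Metric.ball 0 (1 - q / 2)) :=
        hg.analyticOnNhd Metric.isOpen_ball
      have hmax : Set.EqOn g 0 (Metric.ball 0 (1 / 4)) := by
        intro z hz
        have hcl : closure (Metric.ball (0 : ℂ) (1 / 4)) ⊆ Metric.ball 0 (1 - q / 2) := by
          refine Metric.closure_ball_subset_closedBall.trans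
            (Metric.closedBall_subset_ball (by linarith))
        have := Complex.norm_le_of_forall_mem_frontier_norm_le (C := 0) Metric.isBounded_ball
          (hg.mono hcl).diffContOnCl (fun w hw => by
            rw [frontier_ball _ (by norm_num)] at hw
            exact hga w (by simpa using hw)) (subset_closure hz)
        simpa using this
      intro z hz
      exact hga'.eqOn_zero_of_preconnected_of_eventuallyEq_zero
        (convex_ball _ _).isPreconnected (Metric.mem_ball_self (by linarith))
        (hmax.eventuallyEq_of_mem (Metric.ball_mem_nhds _ (by norm_num))) hz
    rw [hzero x (by simp [hx]; linarith)]
    simp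
  -- This outer radius lies strictly between `‖x‖ = 1 - q` and `1 - q / 2`, so closed annuli stay in
  -- the domain. The three lines theorem is applied to `g ∘ exp`. The exponent log(ρ/(1 - q)) /
  -- log(4ρ) is at least (q/4)/2 = q/8.
  set ρ : ℝ := 1 - 3 * q / 4 with hρ
  have hρ0 : 0 < ρ := by rw [hρ]; linarith
  have hx0 : x ≠ 0 := by
    rw [← norm_pos_iff, hx]; linarith
  have hlu : Real.log (1 / 4) < Real.log ρ := Real.log_lt_log (by norm_num) (by rw [hρ]; linarith)
  have hxre : (Complex.log x).re = Real.log (1 - q) := by rw [Complex.log_re, hx]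
  have hball : ∀ z : ℂ, z.re ≤ Real.log ρ → Complex.exp z ∈ Metric.ball (0 : ℂ) (1 - q / 2) := by
    intro z hz
    rw [mem_ball_zero_iff, Complex.norm_exp]
    refine lt_of_le_of_lt (Real.exp_le_exp.2 hz) ?_
    rw [Real.exp_log hρ0, hρ]; linarith
  have hdiff : DifferentiableOn ℂ (fun z => g (Complex.exp z)) {z | z.re ≤ Real.log ρ} :=
    hg.comp Complex.differentiable_exp.differentiableOn fun z hz => hball z hz
  have h14 : Real.log (1 / 4) ≤ Real.log (1 - q) := Real.log_le_log (by norm_num) (by linarith)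
  have hqρ : Real.log (1 - q) ≤ Real.log ρ :=
    Real.log_le_log (by linarith) (by rw [hρ]; linarith)
  have hcl : closure (Complex.HadamardThreeLines.verticalStrip (Real.log (1 / 4)) (Real.log ρ)) ⊆
      {z | z.re ≤ Real.log ρ} := by
    refine closure_minimal (fun z hz => le_of_lt hz.2) (isClosed_le Complex.continuous_re continuous_const)
  have key := Complex.HadamardThreeLines.norm_le_interp_of_mem_verticalClosedStrip'
    (f := fun z => g (Complex.exp z)) (z := Complex.log x) (a := a) (b := 1) hlu
    (by
      change _ ∈ Set.Icc _ _
      rw [hxre]; exact ⟨h14, hqρ⟩)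
    (hdiff.mono hcl).diffContOnCl
    ⟨1, by
      rintro _ ⟨z, hz, rfl⟩
      exact hg1 _ (hball z hz.2)⟩
    (fun z hz => hga _ (by
      rw [Complex.norm_exp, Set.mem_preimage.1 hz, Real.exp_log (by norm_num)]))
    (fun z hz => hg1 _ (hball z (le_of_eq hz)))
  rw [Complex.exp_log hx0, hxre, Real.one_rpow, mul_one] at key
  refine key.trans (Real.rpow_le_rpow_of_exponent_ge ha0 ha1 ?_)
  have hden : 0 < Real.log ρ - Real.log (1 / 4) := by linarith
  have hden2 : Real.log ρ - Real.log (1 / 4) ≤ 2 := by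
    have h1 : Real.log ρ ≤ 0 := Real.log_nonpos hρ0.le (by rw [hρ]; linarith)
    have h2 : Real.log (1 / 4) = -(2 * Real.log 2) := by
      rw [one_div, Real.log_inv, show (4 : ℝ) = 2 ^ 2 by norm_num, Real.log_pow]; push_cast; ring
    have := Real.log_two_lt_d9
    rw [h2]; linarith
  have hnum : q / 4 ≤ Real.log ρ - Real.log (1 - q) := by
    rw [← Real.log_div hρ0.ne' (by linarith)]
    have h3 := Real.one_sub_inv_le_log_of_pos (x := ρ / (1 - q)) (by
      apply div_pos hρ0; linarith)
    refine le_trans ?_ h3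
    rw [inv_div, le_sub_iff_add_le, ← le_sub_iff_add_le', div_le_iff₀ hρ0]
    rw [hρ]; nlinarith
  rw [one_sub_div hden.ne', le_div_iff₀ hden]
  calc q / 8 * (Real.log ρ - Real.log (1 / 4)) ≤ q / 8 * 2 := by gcongr
    _ = q / 4 := by ring
    _ ≤ _ := by linarith

/-- The half-plane `Re w ≤ U` is sent into the unit disc by w ↦ w/(2U - w), so three circles applies
to Φ/(2U - Φ). On `‖z‖ = 1/4` Borel-Carathéodory gives ‖Φ‖ ≤ 2ε, hence a quotient of size at most
2ε/U. Solving ‖Φ‖ ≤ τ(2U + ‖Φ‖) with τ ≤ 1/2 yields the factor 4. -/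
theorem norm_le_of_re_le_of_re_le_near_zero {Φ : ℂ → ℂ} {q U ε : ℝ} {x : ℂ} (hq : 0 < q)
    (hq2 : q ≤ 1 / 2) (hε : 0 < ε) (hU : 4 * ε ≤ U)
    (hΦ : DifferentiableOn ℂ Φ (Metric.ball 0 (1 - q / 2))) (hΦ0 : Φ 0 = 0)
    (hΦU : ∀ z ∈ Metric.ball (0 : ℂ) (1 - q / 2), (Φ z).re ≤ U)
    (hΦε : ∀ z ∈ Metric.ball (0 : ℂ) (1 / 2), (Φ z).re ≤ ε)
    (hx : ‖x‖ = 1 - q) (hτ : (2 * ε / U) ^ (q / 8) ≤ 1 / 2) :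
    ‖Φ x‖ ≤ 4 * U * (2 * ε / U) ^ (q / 8) := by
  have hU0 : 0 < U := by linarith
  have hne : ∀ z ∈ Metric.ball (0 : ℂ) (1 - q / 2), 2 * U - Φ z ≠ 0 := fun z hz h => by
    have := congrArg Complex.re h
    simp at this
    linarith [hΦU z hz]
  have hnorm : ∀ z ∈ Metric.ball (0 : ℂ) (1 - q / 2), ‖Φ z‖ ≤ ‖2 * U - Φ z‖ := fun z hz => by
    refine abs_le_of_sq_le_sq' ?_ (norm_nonneg _) |>.2
    rw [Complex.sq_norm, Complex.sq_norm, Complex.normSq_apply, Complex.normSq_apply]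
    simp
    nlinarith [hΦU z hz]
  have hsmall : ∀ z : ℂ, ‖z‖ = 1 / 4 → ‖Φ z / (2 * U - Φ z)‖ ≤ 2 * ε / U := fun z hz => by
    have hB := Complex.borelCaratheodory_zero (f := Φ) (M := ε) (R := 1 / 2) (z := z) hε
      (hΦ.mono (Metric.ball_subset_ball (by linarith))) (fun w hw => hΦε w hw) (by norm_num)
      (by simp [hz]; norm_num) hΦ0
    rw [hz] at hB
    norm_num at hB
    have h2 : 2 * U - ‖Φ z‖ ≤ ‖2 * U - Φ z‖ := by
      have := norm_sub_norm_le (2 * U : ℂ) (Φ z)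
      simpa [abs_of_pos hU0] using this
    rw [norm_div]
    have h3 : U ≤ ‖2 * U - Φ z‖ := by linarith
    exact div_le_div₀ (by linarith) (by linarith) hU0 h3
  have h := norm_le_rpow_of_three_circles (g := fun z => Φ z / (2 * U - Φ z)) (a := 2 * ε / U)
    (x := x) hq hq2
    (hΦ.div ((differentiableOn_const _).sub hΦ) hne)
    (fun z hz => by
      rw [norm_div]
      exact div_le_one_of_le₀ (hnorm z hz) (norm_nonneg _))
    (by positivity) (by rw [div_le_one hU0]; linarith) hsmall hx
  have hxb : x ∈ Metric.ball (0 : ℂ) (1 - q / 2) := by simp [hx]; linarith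
  have hpos : 0 < ‖2 * U - Φ x‖ := norm_pos_iff.2 (hne x hxb)
  rw [norm_div, div_le_iff₀ hpos] at h
  have h4 : ‖2 * U - Φ x‖ ≤ 2 * U + ‖Φ x‖ := by
    have := norm_sub_le (2 * U : ℂ) (Φ x)
    simpa [abs_of_pos hU0] using this
  set τ := (2 * ε / U) ^ (q / 8)
  have hτ0 : 0 ≤ τ := Real.rpow_nonneg (by positivity) _
  nlinarith [norm_nonneg (Φ x), mul_le_mul_of_nonneg_left h4 hτ0,
    mul_le_mul_of_nonneg_right hτ (norm_nonneg (Φ x))]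

theorem exists_log_on_ball {k : ℂ → ℂ} {R : ℝ} (hR : 0 < R)
    (hk : DifferentiableOn ℂ k (Metric.ball 0 R)) (hk0 : ∀ z ∈ Metric.ball (0 : ℂ) R, k z ≠ 0) :
    ∃ Φ : ℂ → ℂ, DifferentiableOn ℂ Φ (Metric.ball 0 R) ∧ Φ 0 = 0 ∧
      ∀ z ∈ Metric.ball (0 : ℂ) R, k z = k 0 * Complex.exp (Φ z) := by
  have hd : DifferentiableOn ℂ (fun z => deriv k z / k z) (Metric.ball 0 R) :=
    (hk.deriv Metric.isOpen_ball).div hk hk0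
  obtain ⟨g, hg⟩ := hd.isExactOn_ball
  have hmem : (0 : ℂ) ∈ Metric.ball (0 : ℂ) R := Metric.mem_ball_self hR
  refine ⟨fun z => g z - g 0, fun z hz =>
    ((hg z hz).differentiableAt.sub_const _).differentiableWithinAt, by simp, ?_⟩
  have hconst : ∀ z ∈ Metric.ball (0 : ℂ) R,
      k z * Complex.exp (-(g z - g 0)) = k 0 * Complex.exp (-(g 0 - g 0)) := by
    intro z hz
    refine Metric.isOpen_ball.is_const_of_deriv_eq_zero (convex_ball (0 : ℂ) R).isPreconnected
      (f := fun z => k z * Complex.exp (-(g z - g 0))) ?_ ?_ hz hmem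
    · intro w hw
      exact (((hk w hw).differentiableAt (Metric.isOpen_ball.mem_nhds hw)).mul
        ((hg w hw).differentiableAt.sub_const _).neg.cexp).differentiableWithinAt
    · intro w hw
      have h1 := ((hk w hw).differentiableAt (Metric.isOpen_ball.mem_nhds hw)).hasDerivAt
      have h2 := h1.mul ((hg w hw).sub_const (g 0)).neg.cexp
      have h3 := hk0 w hw
      refine h2.deriv.trans ?_
      simp only [Pi.zero_apply, Pi.neg_apply]
      field_simp
      ring
  intro z hz
  have := hconst z hz
  rw [sub_self, neg_zero, Complex.exp_zero, mul_one] at this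
  rw [← this, mul_assoc, ← Complex.exp_add]
  simp

/-- A two-constants theorem for zero-free holomorphic functions on a narrow horizontal strip. -/
theorem norm_le_of_ne_zero_on_strip {H : ℂ → ℂ} {σL σR T δ U ε q : ℝ} (hδ : 0 < δ) (hLR : σL ≤ σR)
    (hqdef : q = Real.exp (-(Real.pi * (σR - σL) / (2 * δ)))) (hq2 : q ≤ 1 / 2)
    (hε : 0 < ε) (hU : 4 * ε ≤ U)
    (hH : ∀ s : ℂ, |s.im - T| < δ → σL - δ < s.re → s.re < σR + δ → DifferentiableAt ℂ H s)
    (hH0 : ∀ s : ℂ, |s.im - T| < δ → σL - δ < s.re → s.re < σR + δ → H s ≠ 0)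
    (hHU : ∀ s : ℂ, |s.im - T| < δ → σL - δ < s.re → s.re < σR + δ →
      ‖H s‖ ≤ Real.exp U * ‖H ⟨σR, T⟩‖)
    (hHε : ∀ s : ℂ, |s.im - T| < δ → σR - δ < s.re → s.re < σR + δ →
      ‖H s‖ ≤ Real.exp ε * ‖H ⟨σR, T⟩‖)
    (hτ : (2 * ε / U) ^ (q / 8) ≤ 1 / 2) :
    ‖H ⟨σL, T⟩‖ ≤ Real.exp (4 * U * (2 * ε / U) ^ (q / 8)) * ‖H ⟨σR, T⟩‖ := by
  have hq : 0 < q := by rw [hqdef]; positivity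
  have hpi := Real.pi_pos
  have hpi3 := Real.pi_gt_three
  set c : ℝ := 2 * δ / Real.pi with hc
  have hc0 : 0 < c := by positivity
  have hcδ : c < δ := by
    rw [hc, div_lt_iff₀ hpi]; nlinarith
  -- For `‖z‖ < 1` the point `1 + z` is in the right half-plane, so its logarithm has |Im| < π/2,
  -- and `c` rescales this to half-width δ. The centre 0 goes to σR + iT. Since c log q = σL - σR,
  -- the point -(1 - q) goes to σL + iT.
  set φ : ℂ → ℂ := fun z => (⟨σR, T⟩ : ℂ) + c * Complex.log (1 + z) with hφ
  have hφre : ∀ z, (φ z).re = σR + c * Real.log ‖1 + z‖ := fun z => by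
    simp [hφ, Complex.log_re]
  have hφim : ∀ z, (φ z).im = T + c * Complex.arg (1 + z) := fun z => by
    simp [hφ, Complex.log_im]
  have hlog2 : Real.log 2 < 1 := by have := Real.log_two_lt_d9; linarith
  have hre : ∀ z : ℂ, ‖z‖ < 1 → 0 < (1 + z).re := fun z hz => by
    have := (abs_le.1 (Complex.abs_re_le_norm z)).1
    simp; linarith
  have him : ∀ z : ℂ, ‖z‖ < 1 → |(φ z).im - T| < δ := fun z hz => by
    rw [hφim, add_sub_cancel_left, abs_mul, abs_of_pos hc0]
    have := Complex.abs_arg_lt_pi_div_two_iff.2 (Or.inl (hre z hz))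
    calc c * |(1 + z).arg| < c * (Real.pi / 2) := by gcongr
      _ = δ := by rw [hc]; field_simp
  have hup : ∀ z : ℂ, ‖z‖ < 1 → (φ z).re < σR + δ := fun z hz => by
    rw [hφre]
    have hn0 : 0 < ‖1 + z‖ := (hre z hz).trans_le (Complex.re_le_norm _)
    have : Real.log ‖1 + z‖ ≤ Real.log 2 := by
      refine Real.log_le_log hn0 ((norm_add_le _ _).trans ?_)
      simp; linarith
    nlinarith
  have hlog : Real.log q = (σL - σR) / c := by
    rw [hqdef, Real.log_exp, hc]; field_simp; ring
  -- Here `‖1 + z‖ ≥ q / 2`; the extra factor 2 costs c log 2 < δ, which explains the margins of δ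
  -- in the hypotheses.
  have hlow : ∀ z ∈ Metric.ball (0 : ℂ) (1 - q / 2), σL - δ < (φ z).re := fun z hz => by
    rw [mem_ball_zero_iff] at hz
    rw [hφre]
    have h1 : q / 2 ≤ ‖1 + z‖ := by
      have := norm_sub_norm_le (1 : ℂ) (-z)
      simp at this
      linarith
    have h2 : Real.log q - Real.log 2 ≤ Real.log ‖1 + z‖ := by
      rw [← Real.log_div hq.ne' (by norm_num)]
      exact Real.log_le_log (by positivity) h1
    rw [hlog] at h2
    have h3 := mul_le_mul_of_nonneg_left h2 hc0.le
    rw [mul_sub, mul_div_cancel₀ _ hc0.ne'] at h3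
    nlinarith
  have hlow' : ∀ z ∈ Metric.ball (0 : ℂ) (1 / 2), σR - δ < (φ z).re := fun z hz => by
    rw [mem_ball_zero_iff] at hz
    rw [hφre]
    have h1 : 1 / 2 ≤ ‖1 + z‖ := by
      have := norm_sub_norm_le (1 : ℂ) (-z)
      simp at this
      linarith
    have h2 : -Real.log 2 ≤ Real.log ‖1 + z‖ := by
      rw [← Real.log_inv]
      exact Real.log_le_log (by positivity) (by simpa using h1)
    nlinarith
  have hb1 : ∀ z ∈ Metric.ball (0 : ℂ) (1 - q / 2), ‖z‖ < 1 := fun z hz => by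
    rw [mem_ball_zero_iff] at hz; linarith
  have hφ0 : φ 0 = ⟨σR, T⟩ := by simp [hφ]
  obtain ⟨Φ, hΦd, hΦ0, hΦ⟩ := exists_log_on_ball (k := fun z => H (φ z)) (R := 1 - q / 2)
    (by linarith)
    (fun z hz => by
      have h1 := hb1 z hz
      have hslit : 1 + z ∈ Complex.slitPlane := Or.inl (hre z h1)
      have hd : DifferentiableAt ℂ φ z :=
        (((differentiableAt_id.const_add 1).clog hslit).const_mul _).const_add _
      exact ((hH _ (him z h1) (hlow z hz) (hup z h1)).comp z hd).differentiableWithinAt)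
    (fun z hz => hH0 _ (him z (hb1 z hz)) (hlow z hz) (hup z (hb1 z hz)))
  rw [hφ0] at hΦ
  have hHR : 0 < ‖H ⟨σR, T⟩‖ := norm_pos_iff.2 <|
    hH0 _ (by simpa using hδ) (by simp only; linarith) (by simp only; linarith)
  have hnorm : ∀ z ∈ Metric.ball (0 : ℂ) (1 - q / 2),
      ‖H (φ z)‖ = Real.exp (Φ z).re * ‖H ⟨σR, T⟩‖ := fun z hz => by
    rw [hΦ z hz, norm_mul, Complex.norm_exp, mul_comm]
  have hx : ‖((-(1 - q) : ℝ) : ℂ)‖ = 1 - q := by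
    rw [Complex.norm_real, norm_neg, Real.norm_of_nonneg (by linarith)]
  have hxb : ((-(1 - q) : ℝ) : ℂ) ∈ Metric.ball (0 : ℂ) (1 - q / 2) := by
    rw [mem_ball_zero_iff, hx]; linarith
  have hφx : φ ((-(1 - q) : ℝ) : ℂ) = ⟨σL, T⟩ := by
    have e : (1 : ℂ) + ((-(1 - q) : ℝ) : ℂ) = (q : ℝ) := by push_cast; ring
    apply Complex.ext
    · rw [hφre, e, Complex.norm_real, Real.norm_of_nonneg hq.le, hlog,
        mul_div_cancel₀ _ hc0.ne']
      simp
    · rw [hφim, e, Complex.arg_ofReal_of_nonneg hq.le]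
      simp
  have hmain := norm_le_of_re_le_of_re_le_near_zero (x := ((-(1 - q) : ℝ) : ℂ)) hq hq2 hε hU hΦd hΦ0
    (fun z hz => by
      have h := hHU _ (him z (hb1 z hz)) (hlow z hz) (hup z (hb1 z hz))
      rw [hnorm z hz] at h
      exact Real.exp_le_exp.1 (le_of_mul_le_mul_right h hHR))
    (fun z hz => by
      have hz' : z ∈ Metric.ball (0 : ℂ) (1 - q / 2) := Metric.ball_subset_ball (by linarith) hz
      have h := hHε _ (him z (hb1 z hz')) (hlow' z hz) (hup z (hb1 z hz'))
      rw [hnorm z hz'] at h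
      exact Real.exp_le_exp.1 (le_of_mul_le_mul_right h hHR))
    hx hτ
  rw [← hφx, hnorm _ hxb]
  gcongr
  exact (Complex.re_le_norm _).trans hmain

/-! ### The Euler product to the right of `Re s = 1 + ϑ` -/

theorem exists_norm_riemannZeta_le :
    ∃ A : ℝ, 1 ≤ A ∧ ∀ x : ℝ, 1 < x → x ≤ 4 → ‖riemannZeta x‖ ≤ A / (x - 1) := by
  have hcont : Continuous fun x : ℝ => riemannZeta₁ (x : ℂ) :=
    differentiable_riemannZeta₁.continuous.comp Complex.continuous_ofReal
  obtain ⟨B, hB⟩ := (isCompact_Icc (a := (1 : ℝ)) (b := 4)).exists_bound_of_continuousOn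
    hcont.continuousOn
  refine ⟨max B 1, le_max_right _ _, fun x hx hx4 => ?_⟩
  have hne : (x : ℂ) ≠ 1 := by exact_mod_cast hx.ne'
  rw [riemannZeta_eq_inv_sub_mul hne, norm_mul, norm_inv, div_eq_inv_mul]
  have : ‖(x : ℂ) - 1‖ = x - 1 := by
    rw [← Complex.ofReal_one, ← Complex.ofReal_sub, Complex.norm_real, Real.norm_of_nonneg]
    linarith
  rw [this]
  have h1 : 0 ≤ (x - 1)⁻¹ := inv_nonneg.2 (by linarith)
  gcongr
  exact (hB x ⟨hx.le, hx4⟩).trans (le_max_left _ _)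

/-- With y = p^(θ - Re s), each |1 - αⱼ p^(-s)| lies between 1 - y and 1 + y ≤ 1/(1 - y). Both
bounds are thus governed by the local factor of ζ^m at Re s - θ. -/
theorem norm_localFactor_bounds {m : ℕ} {α : Fin m → ℂ} {p : Nat.Primes} {θ : ℝ} {s : ℂ}
    (hα : ∀ j, ‖α j‖ ≤ ((p : ℕ) : ℝ) ^ θ) (hs : θ < s.re) :
    ‖localFactor α p s‖ ≤ ((1 - ((p : ℕ) : ℝ) ^ (-(s.re - θ)))⁻¹) ^ m ∧
      1 ≤ ((1 - ((p : ℕ) : ℝ) ^ (-(s.re - θ)))⁻¹) ^ m * ‖localFactor α p s‖ := by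
  have hp : (1 : ℝ) < ((p : ℕ) : ℝ) := by exact_mod_cast p.2.one_lt
  have hp0 : (0 : ℝ) < ((p : ℕ) : ℝ) := by linarith
  set y := ((p : ℕ) : ℝ) ^ (-(s.re - θ)) with hy
  have hy0 : 0 < y := Real.rpow_pos_of_pos hp0 _
  have hy1 : y < 1 := Real.rpow_lt_one_of_one_lt_of_neg hp (by linarith)
  have hterm : ∀ j, ‖α j / ((p : ℕ) : ℂ) ^ s‖ ≤ y := fun j => by
    have h1 : ‖((p : ℕ) : ℂ) ^ s‖ = ((p : ℕ) : ℝ) ^ s.re := by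
      simpa using Complex.norm_cpow_eq_rpow_re_of_pos hp0 s
    rw [norm_div, h1, hy, neg_sub, Real.rpow_sub hp0]
    gcongr
    exact hα j
  have hlow : ∀ j, 1 - y ≤ ‖1 - α j / ((p : ℕ) : ℂ) ^ s‖ := fun j => by
    have := norm_sub_norm_le (1 : ℂ) (α j / ((p : ℕ) : ℂ) ^ s)
    rw [norm_one] at this
    linarith [hterm j]
  have hupp : ∀ j, ‖1 - α j / ((p : ℕ) : ℂ) ^ s‖ ≤ (1 - y)⁻¹ := fun j => by
    have := norm_sub_le (1 : ℂ) (α j / ((p : ℕ) : ℂ) ^ s)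
    rw [norm_one] at this
    rw [le_inv_comm₀ (lt_of_lt_of_le (by linarith) (hlow j)) (by linarith)]
    rw [← one_div, le_div_iff₀ (lt_of_lt_of_le (by linarith) (hlow j))]
    nlinarith [hterm j]
  have hnorm : ‖localFactor α p s‖ = ∏ j, ‖1 - α j / ((p : ℕ) : ℂ) ^ s‖⁻¹ := by
    simp [localFactor, norm_prod]
  have hcard : ∀ c : ℝ, c ^ m = ∏ _j : Fin m, c := fun c => by simp
  have hy1' : 0 < 1 - y := by linarith
  constructor
  · rw [hnorm, hcard]
    refine Finset.prod_le_prod (fun j _ => by positivity) fun j _ => ?_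
    gcongr
    exact hlow j
  · rw [hnorm, hcard, ← Finset.prod_mul_distrib]
    calc (1 : ℝ) = ∏ _j : Fin m, (1 : ℝ) := by simp
      _ ≤ _ := Finset.prod_le_prod (fun _ _ => zero_le_one) fun j _ => ?_
    rw [← div_eq_mul_inv, one_le_div (lt_of_lt_of_le hy1' (hlow j))]
    exact hupp j

namespace LFunction

theorem norm_toFun_bounds (L : LFunction) {s : ℂ} (hs : 1 + L.theta < s.re) :
    ‖L.toFun s‖ ≤ ‖riemannZeta ((s.re - L.theta : ℝ) : ℂ)‖ ^ L.degree ∧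
      1 ≤ ‖riemannZeta ((s.re - L.theta : ℝ) : ℂ)‖ ^ L.degree * ‖L.toFun s‖ := by
  have hθ := L.theta_nonneg
  have hL := L.euler_hasProd s (by linarith)
  have hL' : Tendsto (fun S : Finset Nat.Primes => ∏ p ∈ S, ‖localFactor (L.localParam p) p s‖)
      atTop (𝓝 ‖L.toFun s‖) := by
    have := (show Tendsto _ _ _ from hL).norm
    simpa only [norm_prod, SummationFilter.unconditional_filter] using this
  have hZ := riemannZeta_eulerProduct_hasProd (s := ((s.re - L.theta : ℝ) : ℂ))
    (by rw [Complex.ofReal_re]; linarith)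
  have hZ' : Tendsto (fun S : Finset Nat.Primes =>
      ∏ p ∈ S, ((1 - ((p : ℕ) : ℝ) ^ (-(s.re - L.theta)))⁻¹) ^ L.degree)
      atTop (𝓝 (‖riemannZeta ((s.re - L.theta : ℝ) : ℂ)‖ ^ L.degree)) := by
    have := ((show Tendsto _ _ _ from hZ).norm).pow L.degree
    simp only [norm_prod, SummationFilter.unconditional_filter, ← Finset.prod_pow] at this
    refine this.congr fun S => Finset.prod_congr rfl fun p _ => ?_
    congr 1
    have hp : (1 : ℝ) < ((p : ℕ) : ℝ) := by exact_mod_cast p.2.one_lt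
    have hy1 : ((p : ℕ) : ℝ) ^ (-(s.re - L.theta)) < 1 :=
      Real.rpow_lt_one_of_one_lt_of_neg hp (by linarith)
    have e : (((p : ℕ) : ℂ) ^ (-((s.re - L.theta : ℝ) : ℂ))) =
        ((((p : ℕ) : ℝ) ^ (-(s.re - L.theta)) : ℝ) : ℂ) := by
      rw [Complex.ofReal_cpow (by linarith)]
      push_cast
      rfl
    rw [e, ← Complex.ofReal_one, ← Complex.ofReal_sub, ← Complex.ofReal_inv, Complex.norm_real,
      Real.norm_of_nonneg (inv_nonneg.2 (by linarith))]
  have hb := fun p : Nat.Primes => norm_localFactor_bounds (m := L.degree) (α := L.localParam p) (p := p)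
    (θ := L.theta) (s := s) (L.norm_localParam_le p) (by linarith)
  constructor
  · exact le_of_tendsto_of_tendsto' hL' hZ' fun S =>
      Finset.prod_le_prod (fun _ _ => norm_nonneg _) fun p _ => (hb p).1
  · refine ge_of_tendsto' (hZ'.mul hL') fun S => ?_
    rw [← Finset.prod_mul_distrib]
    calc (1 : ℝ) = ∏ p ∈ S, (1 : ℝ) := by simp
      _ ≤ _ := Finset.prod_le_prod (fun _ _ => zero_le_one) fun p _ => (hb p).2

/-- Uniform bounds for `L(s)` to the right of the line `Re s = 1 + ϑ`. -/
theorem exists_norm_toFun_bounds :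
    ∃ A : ℝ, 1 ≤ A ∧ ∀ (L : LFunction) (s : ℂ), 1 + L.theta < s.re → s.re ≤ 4 →
      ‖L.toFun s‖ ≤ (A / (s.re - L.theta - 1)) ^ L.degree ∧
        1 ≤ (A / (s.re - L.theta - 1)) ^ L.degree * ‖L.toFun s‖ := by
  obtain ⟨A, hA, h⟩ := exists_norm_riemannZeta_le
  refine ⟨A, hA, fun L s hs hs4 => ?_⟩
  have hθ := L.theta_nonneg
  have hz := h (s.re - L.theta) (by linarith) (by linarith)
  obtain ⟨h1, h2⟩ := L.norm_toFun_bounds hs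
  have h3 := pow_le_pow_left₀ (norm_nonneg _) hz L.degree
  exact ⟨h1.trans h3, h2.trans (mul_le_mul_of_nonneg_right h3 (norm_nonneg _))⟩

end LFunction

/-! ### Clearing the poles of `ξ_L`, and its zeros as non-trivial zeros of `L` -/

/-- `Complex.Gammaℝ` takes the default value 0 at its poles and vanishes nowhere else, so this says
that the poles are isolated: they are the zeros of an entire function that is not identically zero.
-/
theorem eventually_Gammaℝ_add_ne_zero (μ ρ : ℂ) :
    ∀ᶠ s in 𝓝[≠] ρ, Complex.Gammaℝ (s + μ) ≠ 0 := by
  by_contra h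
  rw [not_eventually] at h
  have hd : Differentiable ℂ fun s => (Complex.Gammaℝ (s + μ))⁻¹ :=
    Complex.differentiable_Gammaℝ_inv.comp (differentiable_id.add_const μ)
  have h1 := (Complex.analyticOnNhd_univ_iff_differentiable.2 hd).eqOn_zero_of_preconnected_of_frequently_eq_zero
    isPreconnected_univ (Set.mem_univ ρ) (h.mono fun s hs => by simpa using hs)
  have h2 := h1 (Set.mem_univ (1 - μ))
  simp [Complex.Gammaℝ_one] at h2

theorem ite_le_meromorphicOrderAt_inv_Gammaℝ (μ ρ : ℂ) [Decidable (∃ k : ℕ, ρ = -(2 * k) - μ)] :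
    (((if ∃ k : ℕ, ρ = -(2 * k) - μ then 1 else 0 : ℕ) : ℤ) : WithTop ℤ) ≤
      meromorphicOrderAt (fun s => (Complex.Gammaℝ (s + μ))⁻¹) ρ := by
  have hd : Differentiable ℂ fun s => (Complex.Gammaℝ (s + μ))⁻¹ :=
    Complex.differentiable_Gammaℝ_inv.comp (differentiable_id.add_const μ)
  have ha := hd.analyticAt ρ
  split_ifs with h
  · obtain ⟨k, hk⟩ := h
    have h0 : (Complex.Gammaℝ (ρ + μ))⁻¹ = 0 := by
      rw [inv_eq_zero, Complex.Gammaℝ_eq_zero_iff]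
      exact ⟨k, by rw [hk]; ring⟩
    have h1 : meromorphicOrderAt (fun s => (Complex.Gammaℝ (s + μ))⁻¹) ρ ≠ 0 := fun h =>
      ha.meromorphicNFAt.meromorphicOrderAt_eq_zero_iff.1 h h0
    have h2 := ha.meromorphicOrderAt_nonneg
    generalize meromorphicOrderAt (fun s => (Complex.Gammaℝ (s + μ))⁻¹) ρ = o at h1 h2
    induction o using WithTop.recTopCoe with
    | top => exact le_top
    | coe n =>
      norm_cast at h1 h2 ⊢
      omega
  · simpa using ha.meromorphicOrderAt_nonneg

namespace LFunction

theorem meromorphicAt_completed (L : LFunction) (s : ℂ) : MeromorphicAt L.completed s := by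
  by_cases h0 : s = 0
  · exact h0 ▸ L.completed_hasPoleOrderAt_zero.1
  by_cases h1 : s = 1
  · exact h1 ▸ L.completed_hasPoleOrderAt_one.1
  exact (L.completed_analyticAt s (Or.inl ⟨h0, h1⟩)).meromorphicAt

/-- The polynomial `s^r (s - 1)^r` that clears the poles of `ξ_L`. -/
noncomputable def polePoly (L : LFunction) (s : ℂ) : ℂ := s ^ L.poleOrder * (s - 1) ^ L.poleOrder

theorem differentiable_polePoly (L : LFunction) : Differentiable ℂ L.polePoly := by
  unfold polePoly
  fun_prop

theorem meromorphicOrderAt_polePoly (L : LFunction) (s : ℂ) :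
    meromorphicOrderAt L.polePoly s =
      (((if s = 0 ∨ s = 1 then L.poleOrder else 0 : ℕ) : ℤ) : WithTop ℤ) := by
  split_ifs with h
  · rcases h with rfl | rfl
    · have e : L.polePoly = (fun s : ℂ => (s - 1) ^ L.poleOrder) * fun s : ℂ => (s - 0) ^ L.poleOrder := by
        ext s; simp [polePoly, mul_comm]
      rw [e, meromorphicOrderAt_mul_of_ne_zero (by fun_prop) (by simp),
        fun_meromorphicOrderAt_pow_id_sub_const]
      rfl
    · have e : L.polePoly = (fun s : ℂ => s ^ L.poleOrder) * fun s : ℂ => (s - 1) ^ L.poleOrder := by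
        ext s; simp [polePoly]
      rw [e, meromorphicOrderAt_mul_of_ne_zero (by fun_prop) (by simp),
        fun_meromorphicOrderAt_pow_id_sub_const]
      rfl
  · push Not at h
    have ha := L.differentiable_polePoly.analyticAt s
    refine ha.meromorphicNFAt.meromorphicOrderAt_eq_zero_iff.2 ?_
    exact mul_ne_zero (pow_ne_zero _ h.1) (pow_ne_zero _ (sub_ne_zero.2 h.2))

/-- The entire function `s^r (s - 1)^r ξ_L(s)`. -/
noncomputable def entireCompleted (L : LFunction) : ℂ → ℂ :=
  toMeromorphicNFOn (L.completed * L.polePoly) Set.univ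

theorem meromorphicOn_completed_mul (L : LFunction) :
    MeromorphicOn (L.completed * L.polePoly) Set.univ := fun s _ =>
  (L.meromorphicAt_completed s).mul (L.differentiable_polePoly.analyticAt s).meromorphicAt

theorem meromorphicOrderAt_entireCompleted (L : LFunction) (s : ℂ) :
    meromorphicOrderAt L.entireCompleted s = meromorphicOrderAt L.completed s +
      (((if s = 0 ∨ s = 1 then L.poleOrder else 0 : ℕ) : ℤ) : WithTop ℤ) := by
  rw [entireCompleted, meromorphicOrderAt_toMeromorphicNFOn L.meromorphicOn_completed_mul
    (Set.mem_univ s), meromorphicOrderAt_mul (L.meromorphicAt_completed s)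
    (L.differentiable_polePoly.analyticAt s).meromorphicAt, meromorphicOrderAt_polePoly]

/-- Because the poles at 0 and 1 have order exactly r, a positive r leaves `entireCompleted` with
order 0 there. Clearing the poles therefore creates no zeros. -/
theorem meromorphicOrderAt_completed_cases (L : LFunction) (s : ℂ) :
    0 ≤ meromorphicOrderAt L.entireCompleted s ∧
      (0 < meromorphicOrderAt L.entireCompleted s → 0 < meromorphicOrderAt L.completed s) := by
  rw [meromorphicOrderAt_entireCompleted]
  by_cases h : s = 0 ∨ s = 1
  · have hm : min (meromorphicOrderAt L.completed s) 0 = ((-(L.poleOrder : ℤ) : ℤ) : WithTop ℤ) := by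
      rcases h with rfl | rfl
      · exact L.completed_hasPoleOrderAt_zero.2
      · exact L.completed_hasPoleOrderAt_one.2
    rw [if_pos h]
    generalize meromorphicOrderAt L.completed s = o at hm
    induction o using WithTop.recTopCoe with
    | top => simp
    | coe n =>
      norm_cast at hm ⊢
      omega
  · rw [if_neg h]
    push Not at h
    have := (L.completed_analyticAt s (Or.inl h)).meromorphicOrderAt_nonneg
    simpa using this

theorem differentiable_entireCompleted (L : LFunction) : Differentiable ℂ L.entireCompleted :=
  fun s => ((meromorphicNFOn_toMeromorphicNFOn (L.completed * L.polePoly) Set.univ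
    (Set.mem_univ s)).meromorphicOrderAt_nonneg_iff_analyticAt.1
      (L.meromorphicOrderAt_completed_cases s).1).differentiableAt

theorem entireCompleted_eq (L : LFunction) {s : ℂ} (h0 : s ≠ 0) (h1 : s ≠ 1) :
    L.entireCompleted s = L.completed s * L.polePoly s := by
  rw [entireCompleted, toMeromorphicNFOn_eq_toMeromorphicNFAt L.meromorphicOn_completed_mul
    (Set.mem_univ s), toMeromorphicNFAt_eq_self.2]
  · rfl
  · exact ((L.completed_analyticAt s (Or.inl ⟨h0, h1⟩)).mul
      (L.differentiable_polePoly.analyticAt s)).meromorphicNFAt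

theorem norm_entireCompleted_one_sub_conj (L : LFunction) {s : ℂ} (h0 : s ≠ 0) (h1 : s ≠ 1) :
    ‖L.entireCompleted s‖ = ‖L.entireCompleted (1 - conj s)‖ := by
  have h0' : 1 - conj s ≠ 0 := fun h => h1 <| by
    have := congrArg conj (sub_eq_zero.1 h)
    simpa using this.symm
  have h1' : 1 - conj s ≠ 1 := fun h => h0 <| by simpa using h
  rw [L.entireCompleted_eq h0 h1, L.entireCompleted_eq h0' h1', L.functional_equation s h0 h1]
  have e1 : ‖(1 - conj s : ℂ)‖ = ‖s - 1‖ := by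
    rw [← Complex.norm_conj, ← norm_neg]; simp
  have e2 : ‖(1 - conj s : ℂ) - 1‖ = ‖s‖ := by simp
  simp only [polePoly, norm_mul, norm_pow, e1, e2, Complex.norm_conj, L.norm_rootNumber]
  ring

/-- The order of `L` at ρ is that of `ξ_L` plus those of the reciprocal gamma factors. The latter
account for at least all trivial zeros at ρ, and the former is positive. -/
theorem isNontrivialZero_of_entireCompleted_eq_zero (L : LFunction) {ρ : ℂ}
    (h : L.entireCompleted ρ = 0) : L.IsNontrivialZero ρ := by
  classical
  obtain ⟨hc0, hc⟩ := L.meromorphicOrderAt_completed_cases ρ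
  have hne : meromorphicOrderAt L.entireCompleted ρ ≠ 0 := fun h0 =>
    (L.differentiable_entireCompleted.analyticAt ρ).meromorphicNFAt.meromorphicOrderAt_eq_zero_iff.1
      h0 h
  have hpos := hc (lt_of_le_of_ne hc0 hne.symm)
  have hN : (L.conductor : ℂ) ≠ 0 := by exact_mod_cast L.conductor_pos.ne'
  have hev : L.toFun =ᶠ[𝓝[≠] ρ] (fun s : ℂ => ((L.conductor : ℂ) ^ (s / 2))⁻¹) *
      (L.completed * fun s => ∏ j, (Complex.Gammaℝ (s + L.mu j))⁻¹) := by
    have hall : ∀ᶠ s in 𝓝[≠] ρ, ∀ j, Complex.Gammaℝ (s + L.mu j) ≠ 0 :=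
      eventually_all.2 fun j => eventually_Gammaℝ_add_ne_zero _ _
    have hnot : ∀ c : ℂ, ∀ᶠ s in 𝓝[≠] ρ, s ≠ c := fun c => by
      rcases eq_or_ne ρ c with rfl | hc
      · exact self_mem_nhdsWithin
      · exact (continuousAt_id.eventually_ne hc).filter_mono nhdsWithin_le_nhds
    filter_upwards [hall, hnot 0, hnot 1] with s hs hs0 hs1
    have hG : ∏ j, Complex.Gammaℝ (s + L.mu j) ≠ 0 := Finset.prod_ne_zero_iff.2 fun j _ => hs j
    have hNs : (L.conductor : ℂ) ^ (s / 2) ≠ 0 := by simp [Complex.cpow_eq_zero_iff, hN]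
    simp only [Pi.mul_apply, Finset.prod_inv_distrib]
    rw [L.completed_eq s hs0 hs1 fun j k hk => hs j
      (Complex.Gammaℝ_eq_zero_iff.2 ⟨k, by rw [hk]; ring⟩)]
    field_simp
  have hGd : ∀ j, Differentiable ℂ fun s => (Complex.Gammaℝ (s + L.mu j))⁻¹ := fun j =>
    Complex.differentiable_Gammaℝ_inv.comp (differentiable_id.add_const _)
  have hNd : Differentiable ℂ fun s : ℂ => ((L.conductor : ℂ) ^ (s / 2))⁻¹ := fun s =>
    ((differentiableAt_id.div_const 2).const_cpow (Or.inl hN)).inv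
      (by simp [Complex.cpow_eq_zero_iff, hN])
  have hord : meromorphicOrderAt L.toFun ρ = meromorphicOrderAt L.completed ρ +
      ∑ j, meromorphicOrderAt (fun s => (Complex.Gammaℝ (s + L.mu j))⁻¹) ρ := by
    rw [meromorphicOrderAt_congr hev, meromorphicOrderAt_mul_of_ne_zero (hNd.analyticAt ρ)
      (by simp [Complex.cpow_eq_zero_iff, hN]),
      meromorphicOrderAt_mul (L.meromorphicAt_completed ρ), meromorphicOrderAt_fun_prod]
    · exact fun j _ => ((hGd j).analyticAt ρ).meromorphicAt
    · exact ((Differentiable.fun_finsetProd fun j _ => hGd j).analyticAt ρ).meromorphicAt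
  have hsum : ((({j : Fin L.degree | ∃ k : ℕ, ρ = -(2 * k) - L.mu j}.ncard : ℕ) : ℤ) : WithTop ℤ) ≤
      ∑ j, meromorphicOrderAt (fun s => (Complex.Gammaℝ (s + L.mu j))⁻¹) ρ := by
    refine le_trans (le_of_eq ?_)
      (Finset.sum_le_sum fun j _ => ite_le_meromorphicOrderAt_inv_Gammaℝ (L.mu j) ρ)
    rw [Set.ncard_eq_toFinset_card', Set.toFinset_ofPred, Finset.card_filter]
    push_cast
    rfl
  unfold IsNontrivialZero trivialMultiplicity
  rw [hord]
  set n := {j : Fin L.degree | ∃ k : ℕ, ρ = -(2 * k) - L.mu j}.ncard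
  generalize (∑ j, meromorphicOrderAt (fun s => (Complex.Gammaℝ (s + L.mu j))⁻¹) ρ) = S at hsum
  generalize meromorphicOrderAt L.completed ρ = o at hpos
  -- Removing copies of the point 0 only lowers the trivial multiplicity, so truncated subtraction
  -- does no harm.
  have hle : n - (if ρ = 0 then L.poleOrder else 0) ≤ n := Nat.sub_le _ _
  generalize n - (if ρ = 0 then L.poleOrder else 0) = n' at hle
  induction o using WithTop.recTopCoe with
  | top => simp
  | coe a =>
    induction S using WithTop.recTopCoe with
    | top => simp
    | coe b =>
      norm_cast at hpos hsum ⊢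
      omega

end LFunction

/-! ### The function `reduced` and its functional equation -/

/-- The quotient `Γ_ℝ(z + 6) / Γ_ℝ(z)`. -/
noncomputable def gammaCubic (z : ℂ) : ℂ := z * (z + 2) * (z + 4) / (2 * Real.pi) ^ 3

theorem Gammaℝ_add_six {z : ℂ} (hz : 0 < z.re) :
    Complex.Gammaℝ (z + 6) = Complex.Gammaℝ z * gammaCubic z := by
  have h0 : z ≠ 0 := fun h => by simp [h] at hz
  have h2 : z + 2 ≠ 0 := fun h => by
    have := congrArg Complex.re h; simp at this; linarith
  have h4 : z + 4 ≠ 0 := fun h => by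
    have := congrArg Complex.re h; simp at this; linarith
  have e1 : z + 6 = z + 4 + 2 := by ring
  have e2 : z + 4 = z + 2 + 2 := by ring
  rw [e1, Complex.Gammaℝ_add_two h4]
  nth_rewrite 1 [e2]
  rw [Complex.Gammaℝ_add_two h2, Complex.Gammaℝ_add_two h0, gammaCubic]
  have : (Real.pi : ℂ) ≠ 0 := by exact_mod_cast Real.pi_ne_zero
  field_simp

theorem norm_gammaCubic (z : ℂ) :
    ‖gammaCubic z‖ = ‖z‖ * ‖z + 2‖ * ‖z + 4‖ / (2 * Real.pi) ^ 3 := by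
  simp [gammaCubic, abs_of_pos Real.pi_pos]

/-- Two-sided bounds for a cubic factor relative to its size at a reference point. -/
theorem gammaCubic_bounds {z z₀ : ℂ} {D c : ℝ} (hc : 1 ≤ c)
    (hD : ‖z - z₀‖ ≤ D) (hcD : D + 7 ≤ (c - 1) * z.re) :
    (‖z₀‖ + 3) ^ 3 / ‖gammaCubic z‖ ≤ (2 * Real.pi * c) ^ 3 := by
  have hstep : ∀ k : ℝ, 0 ≤ k → k ≤ 4 → ‖z₀‖ + 3 ≤ c * ‖z + k‖ := fun k hk hk4 => by
    have h1 : ‖z₀‖ ≤ ‖z + k‖ + (D + k) := by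
      calc ‖z₀‖ = ‖z + k - (z - z₀) - k‖ := by congr 1; ring
        _ ≤ ‖z + k - (z - z₀)‖ + ‖(k : ℂ)‖ := norm_sub_le _ _
        _ ≤ ‖z + k‖ + ‖z - z₀‖ + ‖(k : ℂ)‖ := by gcongr; exact norm_sub_le _ _
        _ ≤ ‖z + k‖ + (D + k) := by
          rw [Complex.norm_real, Real.norm_of_nonneg hk]; linarith
    have h2 : z.re ≤ ‖z + k‖ := by
      refine le_trans ?_ (Complex.re_le_norm _)
      simp; exact hk
    nlinarith
  have h0 := hstep 0 le_rfl (by norm_num)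
  have h2 := hstep 2 (by norm_num) (by norm_num)
  have h4 := hstep 4 (by norm_num) le_rfl
  push_cast at h0 h2 h4
  rw [add_zero] at h0
  have hB : 0 < ‖z₀‖ + 3 := by positivity
  have hpi := Real.pi_pos
  have hpos : ∀ w : ℂ, ‖z₀‖ + 3 ≤ c * ‖w‖ → 0 < ‖w‖ := fun w hw => by
    rcases (norm_nonneg w).eq_or_lt with h | h
    · rw [← h] at hw; linarith
    · exact h
  rw [norm_gammaCubic, div_div_eq_mul_div, div_le_iff₀
    (mul_pos (mul_pos (hpos _ h0) (hpos _ h2)) (hpos _ h4))]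
  have h02 := mul_le_mul h0 h2 hB.le (by positivity)
  have h024 := mul_le_mul h02 h4 hB.le (by positivity)
  calc (‖z₀‖ + 3) ^ 3 * (2 * Real.pi) ^ 3
      = ((‖z₀‖ + 3) * (‖z₀‖ + 3) * (‖z₀‖ + 3)) * (2 * Real.pi) ^ 3 := by ring
    _ ≤ (c * ‖z‖ * (c * ‖z + 2‖) * (c * ‖z + 4‖)) * (2 * Real.pi) ^ 3 := by gcongr
    _ = _ := by ring

theorem norm_gammaCubic_le {z z₀ : ℂ} {D : ℝ} (hD : ‖z - z₀‖ ≤ D) (hD0 : 0 ≤ D) :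
    ‖gammaCubic z‖ ≤ ((‖z₀‖ + 3) * (1 + D)) ^ 3 := by
  have hpi := Real.pi_gt_three
  have hstep : ∀ k : ℝ, 0 ≤ k → k ≤ 4 → ‖z + k‖ ≤ 2 * Real.pi * ((‖z₀‖ + 3) * (1 + D)) :=
    fun k hk hk4 => by
    have h1 : ‖z + k‖ ≤ ‖z₀‖ + (D + k) := by
      calc ‖z + k‖ = ‖z₀ + (z - z₀) + k‖ := by congr 1; ring
        _ ≤ ‖z₀‖ + ‖z - z₀‖ + ‖(k : ℂ)‖ := norm_add₃_le
        _ ≤ _ := by rw [Complex.norm_real, Real.norm_of_nonneg hk]; linarith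
    have h2 : 0 ≤ ‖z₀‖ * D := by positivity
    have h3 : ‖z₀‖ + (D + k) ≤ 2 * ((‖z₀‖ + 3) * (1 + D)) := by
      nlinarith [norm_nonneg z₀]
    have h4 : 0 ≤ (‖z₀‖ + 3) * (1 + D) := by positivity
    nlinarith
  have h0 := hstep 0 le_rfl (by norm_num)
  have h2 := hstep 2 (by norm_num) (by norm_num)
  have h4 := hstep 4 (by norm_num) le_rfl
  push_cast at h0 h2 h4
  rw [add_zero] at h0
  have hE : 0 ≤ (‖z₀‖ + 3) * (1 + D) := by positivity
  rw [norm_gammaCubic, div_le_iff₀ (by positivity)]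
  calc ‖z‖ * ‖z + 2‖ * ‖z + 4‖ ≤ (2 * Real.pi * ((‖z₀‖ + 3) * (1 + D))) *
        (2 * Real.pi * ((‖z₀‖ + 3) * (1 + D))) * (2 * Real.pi * ((‖z₀‖ + 3) * (1 + D))) := by
        gcongr
    _ = _ := by ring

namespace LFunction

/-- `s^r (s - 1)^r ξ_L(s)` divided by `N_L^{s/2} ∏ⱼ Γ_ℝ(s + μⱼ + 6)`: a multiple of `L(s)` by a
rational function for which the trivial zeros with `Re s > -5` have been removed. -/
noncomputable def reduced (L : LFunction) (s : ℂ) : ℂ :=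
  L.entireCompleted s * ((L.conductor : ℂ) ^ (s / 2))⁻¹ * ∏ j, (Complex.Gammaℝ (s + L.mu j + 6))⁻¹

theorem conductor_ne_zero (L : LFunction) : (L.conductor : ℂ) ≠ 0 := by
  exact_mod_cast L.conductor_pos.ne'

theorem one_le_conductor (L : LFunction) : (1 : ℝ) ≤ L.conductor := by
  exact_mod_cast L.conductor_pos

theorem differentiable_reduced (L : LFunction) : Differentiable ℂ L.reduced := by
  have hNd : Differentiable ℂ fun s : ℂ => ((L.conductor : ℂ) ^ (s / 2))⁻¹ := fun s =>
    ((differentiableAt_id.div_const 2).const_cpow (Or.inl L.conductor_ne_zero)).inv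
      (by simp [Complex.cpow_eq_zero_iff, L.conductor_ne_zero])
  refine (L.differentiable_entireCompleted.mul hNd).mul (Differentiable.fun_finsetProd fun j _ => ?_)
  exact Complex.differentiable_Gammaℝ_inv.comp ((differentiable_id.add_const _).add_const _)

/-- As `Re μⱼ > -1`, the shift by 6 puts the Gamma arguments in the right half-plane, where their
reciprocals do not vanish; so the zero comes from `entireCompleted`. -/
theorem isNontrivialZero_of_reduced_eq_zero (L : LFunction) {ρ : ℂ} (hρ : -5 < ρ.re)
    (h : L.reduced ρ = 0) : L.IsNontrivialZero ρ := by
  refine L.isNontrivialZero_of_entireCompleted_eq_zero ?_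
  rcases mul_eq_zero.1 h with h1 | h1
  · refine (mul_eq_zero.1 h1).resolve_right ?_
    simp [Complex.cpow_eq_zero_iff, L.conductor_ne_zero]
  · obtain ⟨j, -, hj⟩ := Finset.prod_eq_zero_iff.1 h1
    have := L.neg_one_lt_re_mu j
    exact absurd (inv_eq_zero.1 hj)
      (Complex.Gammaℝ_ne_zero_of_re_pos (by simp; linarith))

theorem reduced_eq (L : LFunction) {s : ℂ} (hs : 1 < s.re) :
    L.reduced s = L.toFun s * L.polePoly s * ∏ j, (gammaCubic (s + L.mu j))⁻¹ := by
  have hpos : ∀ j, 0 < (s + L.mu j).re := fun j => by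
    have := L.neg_one_lt_re_mu j
    simp; linarith
  have h0 : s ≠ 0 := fun h => by simp [h] at hs; linarith
  have h1 : s ≠ 1 := fun h => by simp [h] at hs
  have hNs : (L.conductor : ℂ) ^ (s / 2) ≠ 0 := by
    simp [Complex.cpow_eq_zero_iff, L.conductor_ne_zero]
  have hG : ∏ j, Complex.Gammaℝ (s + L.mu j) ≠ 0 := Finset.prod_ne_zero_iff.2 fun j _ =>
    Complex.Gammaℝ_ne_zero_of_re_pos (hpos j)
  rw [reduced, L.entireCompleted_eq h0 h1, L.completed_eq s h0 h1 fun j k hk => by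
    have := hpos j
    rw [hk] at this
    simp at this
    have : (0 : ℝ) ≤ k := Nat.cast_nonneg k
    linarith]
  simp only [Gammaℝ_add_six (hpos _), mul_inv, Finset.prod_mul_distrib, Finset.prod_inv_distrib]
  field_simp

theorem norm_conductor_cpow (L : LFunction) (s : ℂ) :
    ‖((L.conductor : ℂ) ^ (s / 2))⁻¹‖ = ((L.conductor : ℝ) ^ (s.re / 2))⁻¹ := by
  have h : (0 : ℝ) < L.conductor := by exact_mod_cast L.conductor_pos
  have := Complex.norm_cpow_eq_rpow_re_of_pos h (s / 2)
  rw [norm_inv]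
  simp at this
  rw [this]

theorem norm_reduced (L : LFunction) (s : ℂ) :
    ‖L.reduced s‖ = ‖L.entireCompleted s‖ * ((L.conductor : ℝ) ^ (s.re / 2))⁻¹ *
      ∏ j, ‖Complex.Gammaℝ (s + L.mu j + 6)‖⁻¹ := by
  rw [reduced, norm_mul, norm_mul, norm_conductor_cpow, norm_prod]
  simp only [norm_inv]

/-- The functional equation, in terms of `reduced`. -/
theorem norm_reduced_reflect (L : LFunction) {a T : ℝ} (ha : 1 < a) :
    ‖L.reduced ⟨(1 - a) / 2, T⟩‖ = ‖L.reduced ⟨(1 + a) / 2, T⟩‖ * (L.conductor : ℝ) ^ (a / 2) *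
      ∏ j, (‖Complex.Gammaℝ ((⟨(1 - a) / 2, T⟩ : ℂ) + L.mu j + 6 + a)‖ /
        ‖Complex.Gammaℝ ((⟨(1 - a) / 2, T⟩ : ℂ) + L.mu j + 6)‖) := by
  have hN : (0 : ℝ) < L.conductor := by exact_mod_cast L.conductor_pos
  set s : ℂ := ⟨(1 - a) / 2, T⟩ with hs
  have h0 : s ≠ 0 := fun h => by
    have := congrArg Complex.re h
    simp [hs] at this
    linarith
  have h1 : s ≠ 1 := fun h => by
    have := congrArg Complex.re h
    simp [hs] at this
    linarith
  have hc : 1 - conj s = ⟨(1 + a) / 2, T⟩ := by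
    apply Complex.ext
    · simp [hs]; ring
    · simp [hs]
  have hsa : (⟨(1 + a) / 2, T⟩ : ℂ) = s + a := by
    apply Complex.ext
    · simp [hs]; ring
    · simp [hs]
  have hG : ∀ j, 0 < ‖Complex.Gammaℝ (s + L.mu j + 6 + a)‖ := fun j => by
    refine norm_pos_iff.2 (Complex.Gammaℝ_ne_zero_of_re_pos ?_)
    have := L.neg_one_lt_re_mu j
    simp [hs]; linarith
  rw [norm_reduced, norm_reduced, L.norm_entireCompleted_one_sub_conj h0 h1, hc, hsa]
  have e : ∀ j, s + a + L.mu j + 6 = s + L.mu j + 6 + a := fun j => by ring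
  simp only [e, div_eq_mul_inv, Finset.prod_mul_distrib, Finset.prod_inv_distrib]
  have hP := (Finset.prod_pos fun j (_ : j ∈ Finset.univ) => hG j).ne'
  have e2 : (s + a : ℂ).re * 2⁻¹ = s.re * 2⁻¹ + a * 2⁻¹ := by simp; ring
  rw [e2, Real.rpow_add hN]
  field_simp

/-! ### Size of `reduced` on both sides of the critical strip -/

/-- The factor `|iT + μⱼ| + 3` of the analytic conductor. -/
noncomputable def shiftSize (L : LFunction) (T : ℝ) (j : Fin L.degree) : ℝ :=
  ‖Complex.I * T + L.mu j‖ + 3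

theorem three_le_shiftSize (L : LFunction) (T : ℝ) (j : Fin L.degree) : 3 ≤ L.shiftSize T j := by
  simp [shiftSize]

theorem shiftSize_pos (L : LFunction) (T : ℝ) (j : Fin L.degree) : 0 < L.shiftSize T j := by
  linarith [L.three_le_shiftSize T j]

theorem analyticConductor_eq (L : LFunction) (T : ℝ) :
    L.analyticConductor T = L.conductor * ∏ j, L.shiftSize T j := rfl

/-- A lower bound to the left of the critical strip. -/
theorem exists_reduced_left_lower :
    ∃ c > 0, ∀ (L : LFunction) (T a : ℝ), 1 < a → a ≤ 4 →
      c ^ L.degree * √(L.analyticConductor T) * ‖L.reduced ⟨(1 + a) / 2, T⟩‖ ≤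
        ‖L.reduced ⟨(1 - a) / 2, T⟩‖ := by
  obtain ⟨c, hc, h⟩ := exists_sqrt_norm_mul_norm_Gammaℝ_le
  refine ⟨c / 2, by positivity, fun L T a ha ha4 => ?_⟩
  rw [L.norm_reduced_reflect ha]
  set s : ℂ := ⟨(1 - a) / 2, T⟩ with hs
  have hfac : ∀ j, c / 2 * √(L.shiftSize T j) ≤
      ‖Complex.Gammaℝ (s + L.mu j + 6 + a)‖ / ‖Complex.Gammaℝ (s + L.mu j + 6)‖ := fun j => by
    have hmu := L.neg_one_lt_re_mu j
    have hre : 3 ≤ (s + L.mu j + 6).re := by simp [hs]; linarith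
    have h1 := h (s + L.mu j + 6) a hre ha.le (by linarith)
    have hpos : 0 < ‖Complex.Gammaℝ (s + L.mu j + 6)‖ :=
      norm_pos_iff.2 (Complex.Gammaℝ_ne_zero_of_re_pos (by linarith))
    rw [le_div_iff₀ hpos]
    refine le_trans ?_ h1
    have hn := hre.trans (Complex.re_le_norm _)
    have h2 : L.shiftSize T j ≤ 2 ^ 2 * ‖s + L.mu j + 6‖ := by
      have h3 : Complex.I * T + L.mu j = (s + L.mu j + 6) - (((1 - a) / 2 + 6 : ℝ) : ℂ) := by
        apply Complex.ext <;> simp [hs]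
      have h4 := norm_sub_le (s + L.mu j + 6) (((1 - a) / 2 + 6 : ℝ) : ℂ)
      rw [← h3, Complex.norm_real, Real.norm_of_nonneg (by linarith)] at h4
      unfold shiftSize
      linarith
    have h5 : √(L.shiftSize T j) ≤ 2 * √‖s + L.mu j + 6‖ := by
      refine (Real.sqrt_le_sqrt h2).trans (le_of_eq ?_)
      rw [Real.sqrt_mul (by positivity), Real.sqrt_sq (by norm_num)]
    calc c / 2 * √(L.shiftSize T j) * ‖Complex.Gammaℝ (s + L.mu j + 6)‖
        ≤ c / 2 * (2 * √‖s + L.mu j + 6‖) * ‖Complex.Gammaℝ (s + L.mu j + 6)‖ := by gcongr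
      _ = _ := by ring
  have hprod : (c / 2) ^ L.degree * √(∏ j, L.shiftSize T j) ≤
      ∏ j, (‖Complex.Gammaℝ (s + L.mu j + 6 + a)‖ / ‖Complex.Gammaℝ (s + L.mu j + 6)‖) := by
    have : (c / 2) ^ L.degree * √(∏ j, L.shiftSize T j) = ∏ j, (c / 2 * √(L.shiftSize T j)) := by
      rw [Finset.prod_mul_distrib, Real.sqrt_prod _ fun j _ => (L.shiftSize_pos T j).le,
        Finset.prod_const, Finset.card_univ, Fintype.card_fin]
    rw [this]
    exact Finset.prod_le_prod (fun j _ => by positivity) fun j _ => hfac j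
  have hN : √(L.conductor : ℝ) ≤ (L.conductor : ℝ) ^ (a / 2) := by
    rw [Real.sqrt_eq_rpow]
    exact Real.rpow_le_rpow_of_exponent_le L.one_le_conductor (by linarith)
  rw [analyticConductor_eq, Real.sqrt_mul (by positivity)]
  calc (c / 2) ^ L.degree * (√(L.conductor : ℝ) * √(∏ j, L.shiftSize T j)) *
        ‖L.reduced ⟨(1 + a) / 2, T⟩‖
      = ‖L.reduced ⟨(1 + a) / 2, T⟩‖ * √(L.conductor : ℝ) *
        ((c / 2) ^ L.degree * √(∏ j, L.shiftSize T j)) := by ring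
    _ ≤ _ := by gcongr

/-- The size of `s^r (s - 1)^r ∏ⱼ gammaCubic (s + μⱼ)⁻¹` near `iT`, inverted. -/
noncomputable def scale (L : LFunction) (T : ℝ) : ℝ :=
  (((1 + |T|)⁻¹) ^ L.poleOrder) ^ 2 * ∏ j, L.shiftSize T j ^ 3

theorem scale_pos (L : LFunction) (T : ℝ) : 0 < L.scale T :=
  mul_pos (by positivity) (Finset.prod_pos fun j _ => pow_pos (L.shiftSize_pos T j) 3)

theorem norm_reduced_mul_scale (L : LFunction) {s : ℂ} (T : ℝ) (hs : 1 < s.re) :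
    ‖L.reduced s‖ * L.scale T = ‖L.toFun s‖ *
      ((‖s‖ / (1 + |T|)) ^ L.poleOrder * (‖s - 1‖ / (1 + |T|)) ^ L.poleOrder) *
      ∏ j, (L.shiftSize T j ^ 3 / ‖gammaCubic (s + L.mu j)‖) := by
  rw [L.reduced_eq hs, scale, norm_mul, norm_mul, norm_prod, polePoly, norm_mul, norm_pow, norm_pow]
  simp only [norm_inv, div_eq_mul_inv, Finset.prod_mul_distrib, mul_pow]
  ring

theorem shift_sub (L : LFunction) (T : ℝ) (s : ℂ) (j : Fin L.degree) :
    s + L.mu j - (Complex.I * T + L.mu j) = s - Complex.I * T := by ring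

/-- Upper bound for `reduced` to the right of the critical strip. -/
theorem norm_reduced_mul_scale_le (L : LFunction) {s : ℂ} {T K D c : ℝ} (hs : 1 < s.re)
    (hK1 : 1 ≤ K) (hK : ‖L.toFun s‖ ≤ K ^ L.degree) (hD : ‖s - Complex.I * T‖ ≤ D) (hc : 1 ≤ c)
    (hcD : D + 7 ≤ (c - 1) * (s.re - 1)) :
    ‖L.reduced s‖ * L.scale T ≤ (K * (D + 2) ^ 2 * (2 * Real.pi * c) ^ 3) ^ L.degree := by
  have hD0 : 0 ≤ D := (norm_nonneg _).trans hD
  have hT : 0 ≤ |T| := abs_nonneg T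
  have h1 : ‖s‖ ≤ |T| + D := by
    calc ‖s‖ = ‖Complex.I * T + (s - Complex.I * T)‖ := by congr 1; ring
      _ ≤ ‖Complex.I * T‖ + ‖s - Complex.I * T‖ := norm_add_le _ _
      _ ≤ |T| + D := by
        have : ‖Complex.I * (T : ℂ)‖ = |T| := by simp
        linarith
  have h2 : ‖s - 1‖ ≤ |T| + D + 1 := by
    have := norm_sub_le s 1
    rw [norm_one] at this
    linarith
  have hq : ∀ x : ℝ, x ≤ |T| + D + 1 → x / (1 + |T|) ≤ D + 2 := fun x hx => by
    rw [div_le_iff₀ (by positivity)]; nlinarith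
  rw [L.norm_reduced_mul_scale T hs, mul_pow, mul_pow]
  have hr : ∀ x : ℝ, 0 ≤ x → x ≤ |T| + D + 1 →
      (x / (1 + |T|)) ^ L.poleOrder ≤ (D + 2) ^ L.degree := fun x hx0 hx =>
    (pow_le_pow_left₀ (by positivity) (hq x hx) _).trans
      (pow_le_pow_right₀ (by linarith) L.poleOrder_le)
  have hprod : ∏ j, (L.shiftSize T j ^ 3 / ‖gammaCubic (s + L.mu j)‖) ≤
      ((2 * Real.pi * c) ^ 3) ^ L.degree := by
    have : ((2 * Real.pi * c) ^ 3) ^ L.degree = ∏ _j : Fin L.degree, (2 * Real.pi * c) ^ 3 := by simp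
    rw [this]
    refine Finset.prod_le_prod (fun j _ => ?_) fun j _ => ?_
    · have := L.shiftSize_pos T j; positivity
    · have := L.neg_one_lt_re_mu j
      refine gammaCubic_bounds hc ?_ (hcD.trans ?_) (D := D)
      · rw [L.shift_sub]; exact hD
      · have : s.re - 1 ≤ (s + L.mu j).re := by simp; linarith
        have h : 0 ≤ c - 1 := by linarith
        gcongr
  have hpn : 0 ≤ ∏ j, (L.shiftSize T j ^ 3 / ‖gammaCubic (s + L.mu j)‖) :=
    Finset.prod_nonneg fun j _ => by have := L.shiftSize_pos T j; positivity
  have e : ((D + 2) ^ 2) ^ L.degree = (D + 2) ^ L.degree * (D + 2) ^ L.degree := by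
    rw [← mul_pow, sq]
  rw [e]
  gcongr
  · exact hr _ (norm_nonneg _) (by linarith)
  · exact hr _ (norm_nonneg _) h2

/-- Lower bound for `reduced` to the right of the critical strip. -/
theorem one_le_mul_norm_reduced_mul_scale (L : LFunction) {s : ℂ} {T K c : ℝ} (hs : 1 < s.re)
    (hK : 1 ≤ K ^ L.degree * ‖L.toFun s‖) (hD : ‖s - Complex.I * T‖ ≤ 5)
    (hc : 1 ≤ c) (hcD : 7 ≤ (c - 1) * (s.re - 1)) :
    1 ≤ (K * c ^ 2 * 2 ^ 9) ^ L.degree * (‖L.reduced s‖ * L.scale T) := by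
  rw [L.norm_reduced_mul_scale T hs, mul_pow, mul_pow]
  have hT0 : 0 ≤ |T| := abs_nonneg T
  have hT : |T| ≤ ‖s‖ + 5 := by
    calc |T| = ‖Complex.I * (T : ℂ)‖ := by simp
      _ = ‖s - (s - Complex.I * T)‖ := by congr 1; ring
      _ ≤ ‖s‖ + ‖s - Complex.I * T‖ := norm_sub_le _ _
      _ ≤ _ := by linarith
  have hn : ‖s‖ ≤ ‖s - 1‖ + 1 := by
    have := norm_add_le (s - 1) 1
    rwa [sub_add_cancel, norm_one] at this
  have hre : s.re - 1 ≤ ‖s - 1‖ := by simpa using Complex.re_le_norm (s - 1)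
  have hre' : s.re ≤ ‖s‖ := Complex.re_le_norm s
  have hr : ∀ x : ℝ, |T| ≤ x + 6 → s.re - 1 ≤ x →
      1 ≤ c ^ L.degree * (x / (1 + |T|)) ^ L.poleOrder := fun x hx hx' => by
    -- `1 + |T| ≤ x + 7 ≤ x + (c - 1)(Re s - 1) ≤ c x`; this covers small `|T|`, where `s` may be
    -- close to 1.
    have h1 : 1 ≤ c * (x / (1 + |T|)) := by
      rw [← mul_div_assoc, one_le_div (by positivity)]
      nlinarith
    calc (1 : ℝ) ≤ (c * (x / (1 + |T|))) ^ L.poleOrder := one_le_pow₀ h1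
      _ = c ^ L.poleOrder * (x / (1 + |T|)) ^ L.poleOrder := mul_pow _ _ _
      _ ≤ _ := by
        have : 0 ≤ x := by linarith
        gcongr
        exact L.poleOrder_le
  have hprod : 1 ≤ (2 ^ 9) ^ L.degree * ∏ j, (L.shiftSize T j ^ 3 / ‖gammaCubic (s + L.mu j)‖) := by
    have e : ((2 : ℝ) ^ 9) ^ L.degree = ∏ _j : Fin L.degree, (2 : ℝ) ^ 9 := by simp
    rw [e, ← Finset.prod_mul_distrib]
    calc (1 : ℝ) = ∏ _j : Fin L.degree, (1 : ℝ) := by simp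
      _ ≤ _ := Finset.prod_le_prod (fun _ _ => zero_le_one) fun j _ => ?_
    have h := norm_gammaCubic_le (z := s + L.mu j) (z₀ := Complex.I * T + L.mu j) (D := 5)
      (by rw [L.shift_sub]; exact hD) (by norm_num)
    have hmu := L.neg_one_lt_re_mu j
    have hpos : 0 < ‖gammaCubic (s + L.mu j)‖ := by
      have h0 : ∀ k : ℝ, 0 ≤ k → 0 < ‖s + L.mu j + k‖ := fun k hk =>
        lt_of_lt_of_le (by simp; linarith) (Complex.re_le_norm _)
      have h1 := h0 0 le_rfl
      have h2 := h0 2 (by norm_num)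
      have h4 := h0 4 (by norm_num)
      push_cast at h1 h2 h4
      rw [add_zero] at h1
      rw [norm_gammaCubic]
      have := Real.pi_pos
      positivity
    rw [← mul_div_assoc, one_le_div hpos]
    refine h.trans (le_of_eq_of_le (mul_pow _ _ 3) ?_)
    have := L.shiftSize_pos T j
    rw [mul_comm]
    change _ * L.shiftSize T j ^ 3 ≤ _
    gcongr
    norm_num
  have h1 := hr ‖s‖ (by linarith) (by linarith)
  have h2 := hr ‖s - 1‖ (by linarith) hre
  have e : (c ^ 2) ^ L.degree = c ^ L.degree * c ^ L.degree := by rw [← mul_pow, sq]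
  rw [e]
  have h12 := one_le_mul_of_one_le_of_one_le h1 h2
  have h3 := one_le_mul_of_one_le_of_one_le hK (one_le_mul_of_one_le_of_one_le h12 hprod)
  refine h3.trans (le_of_eq ?_)
  ring

end LFunction

/-! ### Growth in a vertical strip and the Phragmén-Lindelöf bound -/

/-- The filter of points of the strip `-5/2 < Re s < 7/2` with `|Im s| → ∞`. -/
def stripAtTop : Filter ℂ :=
  comap (abs ∘ Complex.im) atTop ⊓ 𝓟 (Complex.re ⁻¹' Set.Ioo (-5 / 2) (7 / 2))

/-- `f(s) = O(exp(D (1 + |Im s|)²))` on the strip `-5/2 < Re s < 7/2`. -/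
def HasQuadraticGrowth (f : ℂ → ℂ) : Prop :=
  ∃ D : ℝ, ∀ᶠ s in stripAtTop, ‖f s‖ ≤ Real.exp (D * (1 + |s.im|) ^ 2)

theorem eventually_mem_strip : ∀ᶠ s in stripAtTop, s.re ∈ Set.Ioo (-5 / 2 : ℝ) (7 / 2) :=
  mem_inf_of_right (mem_principal_self _)

theorem stripAtTop_le_cocompact : stripAtTop ≤ cocompact ℂ := by
  rw [← Metric.cobounded_eq_cocompact, ← comap_norm_atTop, ← tendsto_iff_comap]
  refine tendsto_atTop_mono (fun s => Complex.abs_im_le_norm s) ?_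
  exact (tendsto_comap (f := abs ∘ Complex.im)).mono_left inf_le_left

theorem norm_le_of_mem_strip {s : ℂ} (hs : s.re ∈ Set.Ioo (-5 / 2 : ℝ) (7 / 2)) :
    ‖s‖ ≤ 4 * (1 + |s.im|) := by
  have h1 := Complex.norm_le_abs_re_add_abs_im s
  have h2 : |s.re| ≤ 7 / 2 := abs_le.2 ⟨by linarith [hs.1], hs.2.le⟩
  have := abs_nonneg s.im
  linarith

theorem one_le_one_add_abs_sq (y : ℝ) : 1 ≤ (1 + |y|) ^ 2 :=
  one_le_pow₀ (by linarith [abs_nonneg y])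

namespace HasQuadraticGrowth

theorem of_le {f : ℂ → ℂ} (D : ℝ) (h : ∀ s : ℂ, s.re ∈ Set.Ioo (-5 / 2 : ℝ) (7 / 2) →
    ‖f s‖ ≤ Real.exp (D * (1 + |s.im|) ^ 2)) : HasQuadraticGrowth f :=
  ⟨D, eventually_mem_strip.mono fun s hs => h s hs⟩

theorem of_le_exp {f : ℂ → ℂ} (D : ℝ) (hD : 0 ≤ D) (h : ∀ s : ℂ,
    s.re ∈ Set.Ioo (-5 / 2 : ℝ) (7 / 2) → ‖f s‖ ≤ Real.exp D) : HasQuadraticGrowth f :=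
  of_le D fun s hs => (h s hs).trans <| Real.exp_le_exp.2 <|
    le_mul_of_one_le_right hD (one_le_one_add_abs_sq _)

theorem mul {f g : ℂ → ℂ} (hf : HasQuadraticGrowth f) (hg : HasQuadraticGrowth g) :
    HasQuadraticGrowth fun s => f s * g s := by
  obtain ⟨D, hD⟩ := hf
  obtain ⟨E, hE⟩ := hg
  refine ⟨D + E, ?_⟩
  filter_upwards [hD, hE] with s h1 h2
  rw [norm_mul, add_mul, Real.exp_add]
  gcongr

theorem prod {ι : Type*} {S : Finset ι} {f : ι → ℂ → ℂ} (h : ∀ i, HasQuadraticGrowth (f i)) :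
    HasQuadraticGrowth fun s => ∏ i ∈ S, f i s := by
  classical
  induction S using Finset.induction_on with
  | empty => exact of_le_exp 0 le_rfl fun s _ => by simp
  | insert i S hi ih =>
    simp only [Finset.prod_insert hi]
    exact (h i).mul ih

theorem pow {f : ℂ → ℂ} (h : HasQuadraticGrowth f) (n : ℕ) : HasQuadraticGrowth fun s => f s ^ n := by
  have := prod (S := Finset.range n) fun _ : ℕ => h
  simpa using this

/-- `(1 + x)² ≤ 64 exp(x / 4)`. The rate 1/4 is admissible for Phragmén-Lindelöf because it is below
π/6, the strip having width 6. -/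
theorem isBigO {f : ℂ → ℂ} (hf : HasQuadraticGrowth f) :
    ∃ B : ℝ, f =O[stripAtTop] fun s => Real.exp (B * Real.exp (1 / 4 * |s.im|)) := by
  obtain ⟨D, hD⟩ := hf
  refine ⟨|D| * 64, IsBigO.of_bound 1 ?_⟩
  filter_upwards [hD] with s hs
  rw [one_mul, Real.norm_of_nonneg (Real.exp_pos _).le]
  refine hs.trans (Real.exp_le_exp.2 ?_)
  set x := |s.im|
  have hx : 0 ≤ x := abs_nonneg _
  have h1 : (1 + x) / 8 ≤ Real.exp (x / 8) := by
    have := Real.add_one_le_exp (x / 8)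
    linarith
  have h2 : Real.exp (1 / 4 * x) = Real.exp (x / 8) ^ 2 := by
    rw [← Real.exp_nat_mul]; congr 1; push_cast; ring
  have h3 := pow_le_pow_left₀ (by positivity) h1 2
  rw [h2]
  calc D * (1 + x) ^ 2 ≤ |D| * (1 + x) ^ 2 := by gcongr; exact le_abs_self D
    _ = |D| * 64 * ((1 + x) / 8) ^ 2 := by ring
    _ ≤ _ := by gcongr

end HasQuadraticGrowth

theorem hasQuadraticGrowth_sub_const (c : ℂ) : HasQuadraticGrowth fun s => s - c := by
  refine HasQuadraticGrowth.of_le (4 + ‖c‖) fun s hs => ?_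
  have h1 := norm_sub_le s c
  have h2 := norm_le_of_mem_strip hs
  have h3 := Real.add_one_le_exp ((4 + ‖c‖) * (1 + |s.im|) ^ 2)
  have h4 := abs_nonneg s.im
  have h5 : (1 + |s.im|) ≤ (1 + |s.im|) ^ 2 := by nlinarith
  nlinarith [norm_nonneg c, mul_le_mul_of_nonneg_left (one_le_one_add_abs_sq s.im) (norm_nonneg c)]

theorem hasQuadraticGrowth_inv_Gammaℝ {μ : ℂ} (hμ : -1 < μ.re) :
    HasQuadraticGrowth fun s => (Complex.Gammaℝ (s + μ + 6))⁻¹ := by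
  obtain ⟨c, hc, h⟩ := exists_exp_neg_le_norm_Gammaℝ (7 / 2 + μ.re + 6)
  refine HasQuadraticGrowth.of_le (c⁻¹ + (1 + |μ.im|)) fun s hs => ?_
  have h1 := h (s + μ + 6) (by simp; linarith [hs.1]) (by simp; linarith [hs.2])
  rw [norm_inv]
  have hpos : 0 < c * Real.exp (-(Real.pi / 4 * |(s + μ + 6).im|)) := by positivity
  refine (inv_anti₀ hpos h1).trans ?_
  rw [mul_inv, ← Real.exp_neg, neg_neg]
  have h2 : c⁻¹ ≤ Real.exp c⁻¹ := by linarith [Real.add_one_le_exp c⁻¹]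
  have h3 : |(s + μ + 6).im| ≤ |s.im| + |μ.im| := by
    simpa using abs_add_le s.im μ.im
  have h4 := abs_nonneg s.im
  have h4' := abs_nonneg μ.im
  have h5 : Real.pi / 4 * |(s + μ + 6).im| ≤ |s.im| + |μ.im| := by
    have : Real.pi / 4 ≤ 1 := by linarith [Real.pi_le_four]
    have := abs_nonneg (s + μ + 6).im
    nlinarith
  have hc' : 0 < c⁻¹ := by positivity
  calc c⁻¹ * Real.exp (Real.pi / 4 * |(s + μ + 6).im|)
      ≤ Real.exp c⁻¹ * Real.exp (|s.im| + |μ.im|) := by gcongr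
    _ = Real.exp (c⁻¹ + (|s.im| + |μ.im|)) := (Real.exp_add _ _).symm
    _ ≤ _ := by
      refine Real.exp_le_exp.2 ?_
      have h6 := mul_le_mul_of_nonneg_left (one_le_one_add_abs_sq s.im) hc'.le
      have h7 := mul_le_mul_of_nonneg_left (one_le_one_add_abs_sq s.im) h4'
      nlinarith

namespace LFunction

/-- The infimum 1 of the growth exponents need not be attained, but some exponent below 2 is
admissible. -/
theorem hasQuadraticGrowth_completed (L : LFunction) : HasQuadraticGrowth L.completed := by
  obtain ⟨a, ⟨ha0, haO⟩, -, ha2⟩ := L.completed_order.exists_between (show (1 : ℝ) < 2 by norm_num)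
  obtain ⟨C, hC⟩ := (haO.mono stripAtTop_le_cocompact).bound
  refine ⟨|C| + 17, ?_⟩
  filter_upwards [hC, eventually_mem_strip] with s h1 hs
  refine h1.trans ?_
  rw [Real.norm_of_nonneg (Real.exp_pos _).le]
  have h2 : C ≤ Real.exp |C| := by linarith [Real.add_one_le_exp |C|, le_abs_self C]
  have h3 : ‖s‖ ^ a ≤ 1 + ‖s‖ ^ 2 := by
    rcases le_total ‖s‖ 1 with h | h
    · have := Real.rpow_le_one (norm_nonneg s) h ha0
      have := sq_nonneg ‖s‖
      linarith
    · have := Real.rpow_le_rpow_of_exponent_le h ha2.le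
      rw [Real.rpow_two] at this
      linarith
  have h4 := pow_le_pow_left₀ (norm_nonneg s) (norm_le_of_mem_strip hs) 2
  have h5 := one_le_one_add_abs_sq s.im
  calc C * Real.exp (‖s‖ ^ a) ≤ Real.exp |C| * Real.exp (‖s‖ ^ a) := by gcongr
    _ = Real.exp (|C| + ‖s‖ ^ a) := (Real.exp_add _ _).symm
    _ ≤ _ := by
      refine Real.exp_le_exp.2 ?_
      nlinarith [mul_le_mul_of_nonneg_left h5 (abs_nonneg C)]

theorem hasQuadraticGrowth_reduced (L : LFunction) : HasQuadraticGrowth L.reduced := by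
  have hN : HasQuadraticGrowth fun s => ((L.conductor : ℂ) ^ (s / 2))⁻¹ := by
    have hN1 := L.one_le_conductor
    refine HasQuadraticGrowth.of_le_exp (Real.log L.conductor * 2)
      (mul_nonneg (Real.log_nonneg hN1) (by norm_num)) fun s hs => ?_
    rw [norm_conductor_cpow, ← Real.rpow_neg (by linarith), ← Real.rpow_def_of_pos (by linarith)]
    exact Real.rpow_le_rpow_of_exponent_le hN1 (by linarith [hs.1])
  have h0 := hasQuadraticGrowth_sub_const 0
  simp only [sub_zero] at h0
  obtain ⟨D, hD⟩ := ((L.hasQuadraticGrowth_completed.mul ((h0.pow L.poleOrder).mul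
    ((hasQuadraticGrowth_sub_const 1).pow L.poleOrder))).mul hN).mul
      (HasQuadraticGrowth.prod (S := Finset.univ)
        fun j => hasQuadraticGrowth_inv_Gammaℝ (L.neg_one_lt_re_mu j))
  have hne : ∀ᶠ s : ℂ in stripAtTop, s ≠ 0 ∧ s ≠ 1 :=
    stripAtTop_le_cocompact (Filter.inter_mem
      (isCompact_singleton (x := (0 : ℂ))).compl_mem_cocompact
      (isCompact_singleton (x := (1 : ℂ))).compl_mem_cocompact)
  refine ⟨D, ?_⟩
  filter_upwards [hD, hne] with s hs h
  rwa [reduced, L.entireCompleted_eq h.1 h.2, polePoly]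

theorem norm_sub_I_mul_le {s : ℂ} {T b : ℝ} (h : |s.re| ≤ b) :
    ‖s - Complex.I * T‖ ≤ b + |s.im - T| := by
  have := Complex.norm_le_abs_re_add_abs_im (s - Complex.I * T)
  simp at this
  linarith

theorem norm_exp_sq (m T : ℝ) (s : ℂ) :
    ‖Complex.exp (m * (s - Complex.I * T) ^ 2)‖ = Real.exp (m * (s.re ^ 2 - (s.im - T) ^ 2)) := by
  rw [Complex.norm_exp]
  congr 1
  simp [sq]

theorem exists_norm_reduced_right_edge :
    ∃ A : ℝ, 1 ≤ A ∧ ∀ (L : LFunction) (T t : ℝ),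
      ‖L.reduced ⟨7 / 2, t⟩‖ * L.scale T ≤ (A * Real.exp (5 * |t - T|)) ^ L.degree := by
  obtain ⟨A, hA, h⟩ := exists_norm_toFun_bounds
  refine ⟨A * (6 ^ 5 * 7 ^ 3), by nlinarith, fun L T t => ?_⟩
  set s : ℂ := ⟨7 / 2, t⟩ with hs
  set τ := |t - T| with hτ
  have hτ0 : 0 ≤ τ := abs_nonneg _
  have hθ1 := L.theta_le_one
  have h1 := (h L s (by simp [hs]; linarith) (by simp [hs]; norm_num)).1
  have hK : ‖L.toFun s‖ ≤ A ^ L.degree := by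
    refine h1.trans ?_
    have hd : 1 ≤ s.re - L.theta - 1 := by simp [hs]; linarith
    have : 0 ≤ A := by linarith
    gcongr
    exact div_le_self this hd
  have hD : ‖s - Complex.I * T‖ ≤ 4 + τ := by
    have := norm_sub_I_mul_le (s := s) (T := T) (b := 4) (by simp [hs]; norm_num [abs_le])
    exact this
  refine (L.norm_reduced_mul_scale_le (c := 6 + τ) (by simp [hs]; norm_num) hA hK hD (by linarith)
    (by simp [hs]; linarith)).trans ?_
  have he : 6 + τ ≤ 6 * Real.exp τ := by linarith [Real.add_one_le_exp τ]
  have hpi : 2 * Real.pi ≤ 7 := by linarith [Real.pi_lt_d2]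
  have hpi0 := Real.pi_pos
  refine pow_le_pow_left₀ (by positivity) ?_ _
  calc A * (4 + τ + 2) ^ 2 * (2 * Real.pi * (6 + τ)) ^ 3
      = A * (6 + τ) ^ 2 * (2 * Real.pi * (6 + τ)) ^ 3 := by ring
    _ ≤ A * (6 * Real.exp τ) ^ 2 * (7 * (6 * Real.exp τ)) ^ 3 := by gcongr
    _ = A * (6 ^ 5 * 7 ^ 3) * Real.exp τ ^ 5 := by ring
    _ = _ := by rw [← Real.exp_nat_mul]; push_cast; rfl

/-- The edges -5/2 and 7/2 are exchanged by the functional equation and differ by 6, so the Gamma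
quotients are exactly the cubics `gammaCubic`. Together with N_L^3 they give the cube of the
conductor. -/
theorem norm_reduced_left_edge_le (L : LFunction) (T t : ℝ) :
    ‖L.reduced ⟨-5 / 2, t⟩‖ ≤ ‖L.reduced ⟨7 / 2, t⟩‖ *
      ((6 ^ 3 * Real.exp (3 * |t - T|)) ^ L.degree * L.analyticConductor T ^ 3) := by
  have h := L.norm_reduced_reflect (a := 6) (T := t) (by norm_num)
  have e1 : ((1 : ℝ) - 6) / 2 = -5 / 2 := by norm_num
  have e2 : ((1 : ℝ) + 6) / 2 = 7 / 2 := by norm_num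
  rw [e1, e2] at h
  set s : ℂ := ⟨-5 / 2, t⟩ with hs
  set τ := |t - T| with hτ
  have hτ0 : 0 ≤ τ := abs_nonneg _
  rw [h, mul_assoc]
  have hN : (L.conductor : ℝ) ^ ((6 : ℝ) / 2) = (L.conductor : ℝ) ^ 3 := by
    rw [← Real.rpow_natCast]; norm_num
  have hfac : ∀ j, ‖Complex.Gammaℝ (s + L.mu j + 6 + (6 : ℝ))‖ / ‖Complex.Gammaℝ (s + L.mu j + 6)‖ ≤
      6 ^ 3 * Real.exp (3 * τ) * L.shiftSize T j ^ 3 := fun j => by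
    have hmu := L.neg_one_lt_re_mu j
    have hre : 0 < (s + L.mu j + 6).re := by simp [hs]; linarith
    have hpos : 0 < ‖Complex.Gammaℝ (s + L.mu j + 6)‖ :=
      norm_pos_iff.2 (Complex.Gammaℝ_ne_zero_of_re_pos hre)
    have e6 : ((6 : ℝ) : ℂ) = 6 := by norm_num
    rw [e6, Gammaℝ_add_six hre, norm_mul, mul_div_cancel_left₀ _ hpos.ne']
    have hD := norm_gammaCubic_le (z := s + L.mu j + 6) (z₀ := Complex.I * T + L.mu j) (D := 4 + τ)
      (by
        have e : s + L.mu j + 6 - (Complex.I * T + L.mu j) = (s + 6) - Complex.I * T := by ring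
        rw [e]
        have := norm_sub_I_mul_le (s := s + 6) (T := T) (b := 4) (by simp [hs]; norm_num [abs_le])
        simpa [hs, hτ] using this) (by linarith)
    refine hD.trans ?_
    have hB := L.shiftSize_pos T j
    change (L.shiftSize T j * (1 + (4 + τ))) ^ 3 ≤ _
    have he : 1 + (4 + τ) ≤ 6 * Real.exp τ := by linarith [Real.add_one_le_exp τ]
    calc (L.shiftSize T j * (1 + (4 + τ))) ^ 3 ≤ (L.shiftSize T j * (6 * Real.exp τ)) ^ 3 := by gcongr
      _ = 6 ^ 3 * Real.exp τ ^ 3 * L.shiftSize T j ^ 3 := by ring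
      _ = _ := by rw [← Real.exp_nat_mul]; push_cast; rfl
  have hprod := Finset.prod_le_prod (s := Finset.univ)
    (fun j _ => by positivity) fun j (_ : j ∈ Finset.univ) => hfac j
  rw [Finset.prod_mul_distrib, Finset.prod_const, Finset.card_univ, Fintype.card_fin,
    Finset.prod_pow] at hprod
  rw [hN, analyticConductor_eq, mul_pow]
  calc ‖L.reduced ⟨7 / 2, t⟩‖ * ((L.conductor : ℝ) ^ 3 * _)
      ≤ ‖L.reduced ⟨7 / 2, t⟩‖ * ((L.conductor : ℝ) ^ 3 *
        ((6 ^ 3 * Real.exp (3 * τ)) ^ L.degree * (∏ j, L.shiftSize T j) ^ 3)) := by gcongr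
    _ = _ := by ring

theorem one_le_analyticConductor (L : LFunction) (T : ℝ) : 1 ≤ L.analyticConductor T := by
  rw [analyticConductor_eq]
  refine one_le_mul_of_one_le_of_one_le L.one_le_conductor ?_
  calc (1 : ℝ) = ∏ _j : Fin L.degree, (1 : ℝ) := by simp
    _ ≤ _ := Finset.prod_le_prod (fun _ _ => zero_le_one) fun j _ => by
      linarith [L.three_le_shiftSize T j]

/-- The convexity bound in the strip `-5/2 ≤ Re s ≤ 7/2`. -/
theorem exists_norm_reduced_convexity :
    ∃ A : ℝ, 1 ≤ A ∧ ∀ (L : LFunction) (T : ℝ) (s : ℂ), -5 / 2 ≤ s.re → s.re ≤ 7 / 2 →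
      |s.im - T| ≤ 1 → ‖L.reduced s‖ * L.scale T ≤ A ^ L.degree * L.analyticConductor T ^ 3 := by
  obtain ⟨A, hA, hedge⟩ := exists_norm_reduced_right_edge
  refine ⟨A * 6 ^ 3 * Real.exp 30, ?_, fun L T s hs1 hs2 hsT => ?_⟩
  · have := Real.add_one_le_exp 30
    nlinarith
  set m := L.degree with hm
  -- The Gaussian localises at height `T` and absorbs the factors exp(5m|t - T|) and exp(8m|t - T|)
  -- on the edges. The coefficient `m` keeps its cost of the form (constant)^m.
  set P : ℂ → ℂ := fun s => L.reduced s * (Complex.exp (m * (s - Complex.I * T) ^ 2)) with hP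
  have hPd : Differentiable ℂ P := L.differentiable_reduced.mul (by fun_prop)
  have hm0 : (0 : ℝ) ≤ m := Nat.cast_nonneg m
  have hsc := L.scale_pos T
  have hC := L.one_le_analyticConductor T
  have hnormP : ∀ s, ‖P s‖ = ‖L.reduced s‖ * Real.exp (m * (s.re ^ 2 - (s.im - T) ^ 2)) := fun s => by
    rw [hP, norm_mul, ← norm_exp_sq]
    push_cast
    rfl
  have hPO : HasQuadraticGrowth P := by
    refine L.hasQuadraticGrowth_reduced.mul
      (HasQuadraticGrowth.of_le_exp (m * 16) (by positivity) fun s hs => ?_)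
    have := norm_exp_sq m T s
    push_cast at this
    rw [this]
    refine Real.exp_le_exp.2 (mul_le_mul_of_nonneg_left ?_ hm0)
    nlinarith [hs.1, hs.2, sq_nonneg (s.im - T)]
  obtain ⟨B, hB⟩ := hPO.isBigO
  set M : ℝ := (A * 6 ^ 3 * Real.exp 29) ^ m * L.analyticConductor T ^ 3 / L.scale T with hM
  have hright : ∀ t : ℝ, ‖L.reduced ⟨7 / 2, t⟩‖ ≤
      (A * Real.exp (5 * |t - T|)) ^ m / L.scale T := fun t => by
    rw [le_div_iff₀ hsc]; exact hedge L T t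
  -- 8τ - τ² ≤ 16, and 16 + 13 = 29; the edges satisfy σ² ≤ 49/4.
  have hquad : ∀ (n τ σ : ℝ), n ≤ 8 → 0 ≤ τ → σ ^ 2 ≤ 13 →
      Real.exp (n * τ) ^ m * Real.exp (m * (σ ^ 2 - τ ^ 2)) ≤ Real.exp 29 ^ m := fun n τ σ hn hτ hσ => by
    rw [← Real.exp_nat_mul, ← Real.exp_nat_mul, ← Real.exp_add]
    refine Real.exp_le_exp.2 ?_
    have : n * τ + (σ ^ 2 - τ ^ 2) ≤ 29 := by
      nlinarith [sq_nonneg (τ - 4), mul_le_mul_of_nonneg_right hn hτ]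
    nlinarith [mul_le_mul_of_nonneg_left this hm0]
  have hPs : ‖P s‖ ≤ M := by
    refine PhragmenLindelof.vertical_strip (a := -5 / 2) (b := 7 / 2) hPd.diffContOnCl
      ⟨1 / 4, ?_, B, hB⟩ ?_ ?_ hs1 hs2
    · have := Real.pi_gt_three
      rw [lt_div_iff₀ (by norm_num)]
      linarith
    · intro z hz
      have e : z = ⟨-5 / 2, z.im⟩ := Complex.ext hz rfl
      have h1 := L.norm_reduced_left_edge_le T z.im
      have h2 := hright z.im
      have h3 := hquad 8 |z.im - T| z.re le_rfl (abs_nonneg _) (by rw [hz]; norm_num)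
      rw [sq_abs] at h3
      rw [hnormP]
      rw [← e] at h1
      have h4 : Real.exp (8 * |z.im - T|) = Real.exp (5 * |z.im - T|) * Real.exp (3 * |z.im - T|) := by
        rw [← Real.exp_add]; ring_nf
      rw [h4] at h3
      calc ‖L.reduced z‖ * Real.exp (m * (z.re ^ 2 - (z.im - T) ^ 2))
          ≤ ((A * Real.exp (5 * |z.im - T|)) ^ m / L.scale T *
            ((6 ^ 3 * Real.exp (3 * |z.im - T|)) ^ m * L.analyticConductor T ^ 3)) *
              Real.exp (m * (z.re ^ 2 - (z.im - T) ^ 2)) := by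
            gcongr
            exact h1.trans (mul_le_mul_of_nonneg_right h2 (by positivity))
        _ = (A * 6 ^ 3) ^ m * ((Real.exp (5 * |z.im - T|) * Real.exp (3 * |z.im - T|)) ^ m *
              Real.exp (m * (z.re ^ 2 - (z.im - T) ^ 2))) *
              L.analyticConductor T ^ 3 / L.scale T := by
            simp only [mul_pow]; ring
        _ ≤ (A * 6 ^ 3) ^ m * Real.exp 29 ^ m * L.analyticConductor T ^ 3 / L.scale T := by
            gcongr
        _ = M := by rw [hM, mul_pow _ (Real.exp 29)]
    · intro z hz
      have e : z = ⟨7 / 2, z.im⟩ := Complex.ext hz rfl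
      have h2 := hright z.im
      have h3 := hquad 5 |z.im - T| z.re (by norm_num) (abs_nonneg _) (by rw [hz]; norm_num)
      rw [sq_abs] at h3
      rw [hnormP]
      rw [← e] at h2
      calc ‖L.reduced z‖ * Real.exp (m * (z.re ^ 2 - (z.im - T) ^ 2))
          ≤ (A * Real.exp (5 * |z.im - T|)) ^ m / L.scale T *
              Real.exp (m * (z.re ^ 2 - (z.im - T) ^ 2)) := by gcongr
        _ = A ^ m * (Real.exp (5 * |z.im - T|) ^ m *
              Real.exp (m * (z.re ^ 2 - (z.im - T) ^ 2))) / L.scale T := by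
            rw [mul_pow]; ring
        _ ≤ A ^ m * Real.exp 29 ^ m / L.scale T := by gcongr
        _ ≤ M := by
            have hA' : A ^ m ≤ (A * 6 ^ 3) ^ m := by gcongr; linarith
            have hC3 : 1 ≤ L.analyticConductor T ^ 3 := one_le_pow₀ hC
            rw [hM, mul_pow _ (Real.exp 29)]
            refine div_le_div_of_nonneg_right ?_ hsc.le
            refine (mul_le_mul_of_nonneg_right hA' (by positivity)).trans ?_
            exact le_mul_of_one_le_right (by positivity) hC3
  rw [hnormP] at hPs
  -- Undoing the Gaussian for `|Im s - T| ≤ 1` costs e^m, which turns 29 into 30.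
  have hlow : Real.exp (-1) ^ m ≤ Real.exp (m * (s.re ^ 2 - (s.im - T) ^ 2)) := by
    rw [← Real.exp_nat_mul]
    refine Real.exp_le_exp.2 (mul_le_mul_of_nonneg_left ?_ hm0)
    have := (sq_le_one_iff_abs_le_one _).2 hsT
    nlinarith [sq_nonneg s.re]
  have h1 : ‖L.reduced s‖ * Real.exp (-1) ^ m ≤ M :=
    (mul_le_mul_of_nonneg_left hlow (norm_nonneg _)).trans hPs
  rw [hM, le_div_iff₀ hsc] at h1
  have h2 : (Real.exp 1) ^ m * (Real.exp (-1)) ^ m = 1 := by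
    rw [← mul_pow, ← Real.exp_add]; simp
  have h3 : Real.exp 30 = Real.exp 29 * Real.exp 1 := by rw [← Real.exp_add]; norm_num
  calc ‖L.reduced s‖ * L.scale T
      = Real.exp 1 ^ m * (‖L.reduced s‖ * Real.exp (-1) ^ m * L.scale T) := by
        linear_combination (-(‖L.reduced s‖ * L.scale T)) * h2
    _ ≤ Real.exp 1 ^ m * ((A * 6 ^ 3 * Real.exp 29) ^ m * L.analyticConductor T ^ 3) := by gcongr
    _ = _ := by rw [h3]; simp only [mul_pow]; ring

/-- Two-sided bounds to the right of `Re s = 1 + ϑ + δ`. -/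
theorem exists_norm_reduced_right_bounds :
    ∃ A : ℝ, 1 ≤ A ∧ ∀ (L : LFunction) (T δ : ℝ) (s : ℂ), 0 < δ → δ ≤ 1 →
      1 + L.theta + δ ≤ s.re → s.re ≤ 7 / 2 → |s.im - T| ≤ 1 →
      ‖L.reduced s‖ * L.scale T ≤ ((A / δ) ^ 4) ^ L.degree ∧
        1 ≤ ((A / δ) ^ 4) ^ L.degree * (‖L.reduced s‖ * L.scale T) := by
  obtain ⟨A, hA, h⟩ := exists_norm_toFun_bounds
  refine ⟨A * (7 ^ 2 * (7 * 13) ^ 3), by nlinarith, fun L T δ s hδ hδ1 hs hs' hT => ?_⟩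
  have hθ := L.theta_nonneg
  have hA0 : 0 ≤ A := by linarith
  obtain ⟨h1, h2⟩ := h L s (by linarith) (by linarith)
  have hAδ : A / (s.re - L.theta - 1) ≤ A / δ := by gcongr; linarith
  have hd0 : 0 ≤ A / (s.re - L.theta - 1) := div_nonneg hA0 (by linarith)
  have hpow := pow_le_pow_left₀ hd0 hAδ L.degree
  have h1' := h1.trans hpow
  have h2' := h2.trans (mul_le_mul_of_nonneg_right hpow (norm_nonneg _))
  have hD : ‖s - Complex.I * T‖ ≤ 5 := by
    refine (norm_sub_I_mul_le (b := 7 / 2) ?_).trans (by linarith)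
    rw [abs_of_nonneg (by linarith)]; exact hs'
  have hδinv : 1 ≤ 1 / δ := by rw [one_le_div hδ]; exact hδ1
  -- Since `Re s - 1 ≥ δ`, the choice c = 13/δ gives (c - 1)(Re s - 1) ≥ 13 - δ ≥ 12 = 5 + 7.
  have hc : (1 : ℝ) ≤ 13 / δ := by rw [one_le_div hδ]; linarith
  have hcD : (5 : ℝ) + 7 ≤ (13 / δ - 1) * (s.re - 1) := by
    have h3 : (13 / δ - 1) * δ ≤ (13 / δ - 1) * (s.re - 1) :=
      mul_le_mul_of_nonneg_left (by linarith) (by linarith)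
    have h4 : (13 / δ - 1) * δ = 13 - δ := by field_simp
    linarith
  have hpi : 2 * Real.pi ≤ 7 := by linarith [Real.pi_lt_d2]
  have hpi0 := Real.pi_pos
  constructor
  · refine (L.norm_reduced_mul_scale_le (by linarith)
      (by rw [one_le_div hδ]; linarith) h1' hD hc hcD).trans ?_
    refine pow_le_pow_left₀ (by positivity) ?_ _
    calc A / δ * (5 + 2) ^ 2 * (2 * Real.pi * (13 / δ)) ^ 3
        ≤ A / δ * (5 + 2) ^ 2 * (7 * (13 / δ)) ^ 3 := by gcongr
      _ = A * (7 ^ 2 * (7 * 13) ^ 3) / δ ^ 4 := by field_simp; norm_num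
      _ ≤ (A * (7 ^ 2 * (7 * 13) ^ 3)) ^ 4 / δ ^ 4 := by
        gcongr
        exact le_self_pow₀ (by nlinarith) (by norm_num)
      _ = _ := by rw [div_pow]
  · refine (L.one_le_mul_norm_reduced_mul_scale (by linarith) h2' hD hc (by linarith)).trans ?_
    have := L.scale_pos T
    have hkey : A / δ * (13 / δ) ^ 2 * 2 ^ 9 ≤ (A * (7 ^ 2 * (7 * 13) ^ 3) / δ) ^ 4 := by
      calc A / δ * (13 / δ) ^ 2 * 2 ^ 9 = A * (13 ^ 2 * 2 ^ 9) * (1 / δ) ^ 3 := by field_simp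
        _ ≤ A * (7 ^ 2 * (7 * 13) ^ 3) * (1 / δ) ^ 4 :=
          mul_le_mul (mul_le_mul_of_nonneg_left (by norm_num) hA0)
            (pow_le_pow_right₀ hδinv (by norm_num)) (by positivity) (by positivity)
        _ ≤ (A * (7 ^ 2 * (7 * 13) ^ 3)) ^ 4 * (1 / δ) ^ 4 := by
          gcongr
          exact le_self_pow₀ (by nlinarith) (by norm_num)
        _ = _ := by rw [← mul_pow, mul_one_div]
    gcongr

/-! ### The contradiction, and the choice of δ -/

/-- If `log C_L(T)` is large enough compared with `1 / δ`, then there is a non-trivial zero in the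
strip `|Im s - T| < δ`. -/
theorem exists_nontrivialZero_of_bounds :
    ∃ A : ℝ, 1 ≤ A ∧ ∀ (L : LFunction) (T δ q Λ : ℝ), 0 < δ → δ ≤ 1 / 10 → 1 ≤ Λ →
      L.analyticConductor T = Real.exp (L.degree * Λ) →
      q = Real.exp (-(Real.pi * (1 + 2 * L.theta + 4 * δ) / (2 * δ))) → q ≤ 1 / 2 →
      A + 48 * Real.log (A / δ) ≤ √Λ → 80 ≤ q * Real.log Λ →
      ∃ ρ : ℂ, L.IsNontrivialZero ρ ∧ |ρ.im - T| < δ := by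
  obtain ⟨A₁, hA₁, hright⟩ := exists_norm_reduced_right_bounds
  obtain ⟨A₂, hA₂, hconv⟩ := exists_norm_reduced_convexity
  obtain ⟨c, hc, hleft⟩ := exists_reduced_left_lower
  set A := max A₁ (max (4 * |Real.log c|) (Real.log A₂)) with hAdef
  have hAA₁ : A₁ ≤ A := le_max_left _ _
  have hAc : 4 * |Real.log c| ≤ A := (le_max_left _ _).trans (le_max_right _ _)
  have hAA₂ : Real.log A₂ ≤ A := (le_max_right _ _).trans (le_max_right _ _)
  refine ⟨A, hA₁.trans hAA₁, fun L T δ q Λ hδ hδ1 hΛ hC hq hq2 hbig hqΛ => ?_⟩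
  by_contra! hno
  set m := L.degree with hm
  have hm1 : (1 : ℝ) ≤ m := by exact_mod_cast L.degree_pos
  have hθ := L.theta_nonneg
  have hθ1 := L.theta_le_one
  have hA0 : 0 < A := by linarith
  set ℓ := Real.log (A / δ) with hℓ
  have hℓ0 : 0 < ℓ := Real.log_pos (by rw [lt_div_iff₀ hδ]; linarith)
  have hsqrt : √Λ ≤ Λ := by
    rw [Real.sqrt_le_left (by linarith)]; nlinarith
  have hsqrt0 : 0 < √Λ := Real.sqrt_pos.2 (by linarith)
  have hsc := L.scale_pos T
  have hpowA : ∀ n : ℕ, ((A₁ / δ) ^ n) ^ m ≤ Real.exp (m * (n * ℓ)) := fun n => by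
    rw [Real.exp_nat_mul, Real.exp_nat_mul, hℓ, Real.exp_log (by positivity)]
    gcongr
  have hrt : ∀ s : ℂ, |s.im - T| < δ → 1 + L.theta + δ ≤ s.re → s.re ≤ 7 / 2 →
      ‖L.reduced s‖ * L.scale T ≤ Real.exp (m * (4 * ℓ)) ∧
        1 ≤ Real.exp (m * (4 * ℓ)) * (‖L.reduced s‖ * L.scale T) := fun s h1 h2 h3 => by
    obtain ⟨hu, hl⟩ := hright L T δ s hδ (by linarith) h2 h3 (by linarith)
    have h4 := hpowA 4
    push_cast at h4
    exact ⟨hu.trans h4, hl.trans (mul_le_mul_of_nonneg_right h4 (by positivity))⟩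
  -- The Euler product bounds hold on the whole δ-neighbourhood of this abscissa; σL is its mirror
  -- image 1 - σR.
  set σR := 1 + L.theta + 2 * δ with hσR
  set σL := -L.theta - 2 * δ with hσL
  have hR := hrt ⟨σR, T⟩ (by simpa using hδ) (by simp only [hσR]; linarith)
    (by simp only [hσR]; linarith)
  have hU4 : 4 * (m * (8 * ℓ)) ≤ 4 * (m * Λ) := by nlinarith
  have hτeq : 2 * (m * (8 * ℓ)) / (4 * (m * Λ)) = 4 * ℓ / Λ := by
    field_simp; norm_num
  -- 4ℓ ≤ √Λ bounds the base by Λ^(-1/2), so the power is at most exp(-q log Λ / 16) ≤ e^(-5) <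
  -- 1/80.
  have hτsmall : (2 * (m * (8 * ℓ)) / (4 * (m * Λ))) ^ (q / 8) ≤ 1 / 80 := by
    rw [hτeq]
    have hq0 : 0 < q := by rw [hq]; positivity
    have h1 : 4 * ℓ / Λ ≤ Λ ^ (-(1 / 2) : ℝ) := by
      rw [Real.rpow_neg (by linarith), ← Real.sqrt_eq_rpow, div_le_iff₀ (by linarith),
        inv_mul_eq_div, Real.div_sqrt]
      linarith
    calc (4 * ℓ / Λ) ^ (q / 8) ≤ (Λ ^ (-(1 / 2) : ℝ)) ^ (q / 8) :=
          Real.rpow_le_rpow (by positivity) h1 (by positivity)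
      _ = Real.exp (-(q * Real.log Λ / 16)) := by
          rw [← Real.rpow_mul (by linarith), Real.rpow_def_of_pos (by linarith)]
          congr 1; ring
      _ ≤ Real.exp (-5) := Real.exp_le_exp.2 (by linarith)
      _ ≤ 1 / 80 := by
          rw [Real.exp_neg, ← one_div]
          refine one_div_le_one_div_of_le (by norm_num) ?_
          have : Real.exp 5 = Real.exp 1 ^ 5 := by rw [← Real.exp_nat_mul]; norm_num
          rw [this]
          have h27 := Real.exp_one_gt_d9.le
          calc (80 : ℝ) ≤ 2.7 ^ 5 := by norm_num
            _ ≤ _ := by gcongr; linarith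
  -- Dividing by the value at σR + iT costs exp(4mℓ). Hence ε = 4mℓ + 4mℓ near σR, while U = 4mΛ
  -- covers 3mΛ from the cube of the conductor plus m(A + 4ℓ) ≤ mΛ.
  have key := norm_le_of_ne_zero_on_strip (H := L.reduced) (σL := σL) (σR := σR) (T := T) (δ := δ)
    (U := 4 * (m * Λ)) (ε := m * (8 * ℓ)) (q := q) hδ (by rw [hσL, hσR]; linarith)
    (by rw [hq, hσL, hσR]; congr 3; ring) hq2 (by positivity) hU4
    (fun s _ _ _ => L.differentiable_reduced s)
    (fun s h1 h2 _ h0 => absurd h1 (not_lt.2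
      (hno s (L.isNontrivialZero_of_reduced_eq_zero (by linarith) h0))))
    (fun s h1 h2 h3 => by
      have hc1 := hconv L T s (by linarith) (by linarith) (by linarith)
      have hA₂m : A₂ ^ m ≤ Real.exp (m * A) := by
        rw [Real.exp_nat_mul]
        gcongr
        rw [← Real.exp_log (show 0 < A₂ by linarith)]
        exact Real.exp_le_exp.2 hAA₂
      have hle : ‖L.reduced s‖ * L.scale T ≤
          Real.exp (4 * (m * Λ)) * (‖L.reduced ⟨σR, T⟩‖ * L.scale T) := by
        calc ‖L.reduced s‖ * L.scale T ≤ A₂ ^ m * L.analyticConductor T ^ 3 := hc1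
          _ ≤ Real.exp (m * A) * Real.exp (m * Λ) ^ 3 := by rw [hC]; gcongr
          _ ≤ Real.exp (m * A) * Real.exp (m * Λ) ^ 3 *
              (Real.exp (m * (4 * ℓ)) * (‖L.reduced ⟨σR, T⟩‖ * L.scale T)) :=
            le_mul_of_one_le_right (by positivity) hR.2
          _ = Real.exp (m * A + 3 * (m * Λ) + m * (4 * ℓ)) *
              (‖L.reduced ⟨σR, T⟩‖ * L.scale T) := by
            rw [Real.exp_add, Real.exp_add, ← mul_assoc, ← Real.exp_nat_mul]; push_cast; ring
          _ ≤ _ := by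
            have : A + 4 * ℓ ≤ Λ := by linarith
            gcongr
            nlinarith [mul_le_mul_of_nonneg_left this (show (0 : ℝ) ≤ m by linarith)]
      rw [← mul_assoc] at hle
      exact le_of_mul_le_mul_right hle hsc)
    (fun s h1 h2 h3 => by
      have hu := (hrt s h1 (by linarith) (by linarith)).1
      have hle : ‖L.reduced s‖ * L.scale T ≤
          Real.exp (m * (8 * ℓ)) * (‖L.reduced ⟨σR, T⟩‖ * L.scale T) := by
        calc ‖L.reduced s‖ * L.scale T ≤ Real.exp (m * (4 * ℓ)) := hu
          _ ≤ Real.exp (m * (4 * ℓ)) *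
              (Real.exp (m * (4 * ℓ)) * (‖L.reduced ⟨σR, T⟩‖ * L.scale T)) :=
            le_mul_of_one_le_right (by positivity) hR.2
          _ = _ := by rw [← mul_assoc, ← Real.exp_add]; congr 2; ring
      rw [← mul_assoc] at hle
      exact le_of_mul_le_mul_right hle hsc)
    (hτsmall.trans (by norm_num))
  have hlow := hleft L T (1 + 2 * L.theta + 4 * δ) (by linarith) (by linarith)
  have e1 : (1 + (1 + 2 * L.theta + 4 * δ)) / 2 = σR := by rw [hσR]; ring
  have e2 : (1 - (1 + 2 * L.theta + 4 * δ)) / 2 = σL := by rw [hσL]; ring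
  rw [e1, e2] at hlow
  have hRpos : 0 < ‖L.reduced ⟨σR, T⟩‖ := by
    rcases (norm_nonneg (L.reduced ⟨σR, T⟩)).eq_or_lt with h | h
    · have := hR.2
      rw [← h] at this
      norm_num at this
    · exact h
  have h1 := le_of_mul_le_mul_right (hlow.trans key) hRpos
  have hcm : c ^ m = Real.exp (m * Real.log c) := by
    rw [Real.exp_nat_mul, Real.exp_log hc]
  rw [hcm, hC, ← Real.exp_half, ← Real.exp_add, Real.exp_le_exp] at h1
  -- The upper bound becomes mΛ/5, against m(Λ/2 + log c) from the functional equation; Λ exceeds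
  -- 4|log c|.
  have h2 : 4 * (4 * (m * Λ)) * (2 * (m * (8 * ℓ)) / (4 * (m * Λ))) ^ (q / 8) ≤
      4 * (4 * (m * Λ)) * (1 / 80) := by gcongr
  have h3 : (m : ℝ) * (Real.log c + Λ / 2 - Λ / 5) ≤ 0 := by linarith
  have h4 : 0 < Real.log c + Λ / 2 - Λ / 5 := by
    have := neg_abs_le (Real.log c)
    linarith
  nlinarith

theorem analyticConductor_eq_exp (L : LFunction) (T : ℝ) :
    L.analyticConductor T = Real.exp (L.degree * Real.log (L.rootAnalyticConductor T)) := by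
  have hpos : 0 < L.analyticConductor T := by linarith [L.one_le_analyticConductor T]
  have hm : (L.degree : ℝ) ≠ 0 := by exact_mod_cast L.degree_pos.ne'
  rw [rootAnalyticConductor, Real.log_rpow hpos, ← mul_assoc, mul_one_div_cancel hm, one_mul,
    Real.exp_log hpos]

end LFunction

theorem eventually_iteratedLog_bounds (A c : ℝ) :
    ∀ᶠ X in atTop, 1 ≤ Real.log X ∧ c ≤ Real.log (Real.log (Real.log X)) ∧
      A + 48 * Real.log (A * Real.log (Real.log (Real.log X))) ≤ √(Real.log X) := by
  have hlog := Real.tendsto_log_atTop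
  have h1 := hlog.eventually_ge_atTop 1
  have h2 := ((hlog.comp hlog).comp hlog).eventually_ge_atTop c
  have h3 : ∀ᶠ u : ℝ in atTop, A + 48 * Real.log (A * u) ≤ u / 2 := by
    have := (Real.isLittleO_log_id_atTop).bound (show (0 : ℝ) < 1 / 192 by norm_num)
    filter_upwards [this, eventually_ge_atTop (4 * (A + 48 * Real.log A)), eventually_gt_atTop 0,
      eventually_ge_atTop (4 * A)] with u hu h4 h0 h5
    simp only [id, Real.norm_eq_abs, abs_of_pos h0] at hu
    have := le_abs_self (Real.log u)
    rcases eq_or_ne A 0 with rfl | hA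
    · simp; linarith
    · rw [Real.log_mul hA h0.ne']; linarith
  have h4 := ((hlog.comp hlog).comp hlog).eventually h3
  have h5 := ((hlog.comp hlog).eventually_ge_atTop 1)
  filter_upwards [h1, h2, h4, h5] with X h1 h2 h4 h5
  refine ⟨h1, h2, h4.trans ?_⟩
  simp only [Function.comp] at h5 ⊢
  have h6 : Real.log (Real.log (Real.log X)) ≤ Real.log (Real.log X) := by
    have := Real.log_le_sub_one_of_pos (show 0 < Real.log (Real.log X) by linarith)
    linarith
  have h0 : 0 < Real.log X := by linarith
  have h7 : Real.log (√(Real.log X)) = Real.log (Real.log X) / 2 := Real.log_sqrt h0.le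
  have h8 := Real.log_le_sub_one_of_pos (Real.sqrt_pos.2 h0)
  linarith

theorem theorem2 :
    ∃ X₀ C : ℝ, ∀ (L : LFunction) (T : ℝ), X₀ ≤ L.rootAnalyticConductor T →
      ∃ ρ : ℂ, L.IsNontrivialZero ρ ∧
        |ρ.im - T| ≤
          Real.pi / 2 * (1 + 2 * L.theta) /
              Real.log (Real.log (Real.log (L.rootAnalyticConductor T))) +
            C / Real.log (Real.log (Real.log (L.rootAnalyticConductor T))) ^ 2 := by
  obtain ⟨A, hA, h⟩ := LFunction.exists_nontrivialZero_of_bounds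
  -- The 4δ in σR - σL contributes 2π to -log q, and log 80 makes q log Λ exactly 80 for the δ
  -- chosen below.
  set c : ℝ := 2 * Real.pi + Real.log 80 with hc
  have hpi := Real.pi_gt_three
  have hpi4 := Real.pi_le_four
  have hc0 : 6 < c := by
    have : 0 < Real.log 80 := Real.log_pos (by norm_num)
    linarith
  -- `u ≥ 2c + 120` gives both δ ≤ 1/10 and u ≤ 2(u - c).
  obtain ⟨X₀, hX⟩ := eventually_atTop.1 (eventually_iteratedLog_bounds A (2 * c + 120))
  refine ⟨X₀, 3 * Real.pi * c, fun L T hLT => ?_⟩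
  obtain ⟨hΛ, hu, hbig⟩ := hX _ hLT
  set Λ := Real.log (L.rootAnalyticConductor T) with hΛdef
  set u := Real.log (Real.log Λ) with hudef
  have hθ := L.theta_nonneg
  have hθ1 := L.theta_le_one
  set W := 1 + 2 * L.theta with hW
  have hu0 : 0 < u := by linarith
  have huc : 0 < u - c := by linarith
  set δ := Real.pi / 2 * W / (u - c) with hδ
  have hW1 : 1 ≤ W := by linarith
  have hW3 : W ≤ 3 := by linarith
  have hδ0 : 0 < δ := by positivity
  have hδ1 : δ ≤ 1 / 10 := by
    rw [hδ, div_le_iff₀ huc]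
    nlinarith
  have hexp : Real.pi * (W + 4 * δ) / (2 * δ) = u - Real.log 80 := by
    have h1 : Real.pi * W / (2 * δ) = u - c := by
      rw [hδ]; field_simp
    have h2 : Real.pi * (W + 4 * δ) / (2 * δ) = Real.pi * W / (2 * δ) + 2 * Real.pi := by
      field_simp; ring
    rw [h2, h1, hc]; ring
  -- `Real.log 0 = 0`, so positivity of `u` rules out `log Λ = 0`.
  have hlogΛ : 0 < Real.log Λ := by
    rcases (Real.log_nonneg hΛ).eq_or_lt with h0 | h0
    · rw [hudef, ← h0, Real.log_zero] at hu0
      exact absurd hu0 (lt_irrefl _)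
    · exact h0
  have hq : Real.exp (-(Real.pi * (W + 4 * δ) / (2 * δ))) * Real.log Λ = 80 := by
    rw [hexp]
    have hexpu : Real.exp u = Real.log Λ := Real.exp_log hlogΛ
    rw [← hexpu, ← Real.exp_add, neg_sub, sub_add_cancel, Real.exp_log (by norm_num)]
  obtain ⟨ρ, hρ, hρT⟩ := h L T δ _ Λ hδ0 hδ1 hΛ (L.analyticConductor_eq_exp T) rfl
    (by
      rw [hexp]
      have h1 : Real.exp (-(u - Real.log 80)) ≤ Real.exp (-1) :=
        Real.exp_le_exp.2 (by linarith)
      have h2 : Real.exp (-1) ≤ 1 / 2 := by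
        rw [Real.exp_neg, ← one_div]
        exact one_div_le_one_div_of_le (by norm_num) (by linarith [Real.exp_one_gt_d9])
      exact h1.trans h2)
    (by
      refine le_trans ?_ hbig
      have : A / δ ≤ A * u := by
        rw [div_le_iff₀ hδ0, mul_assoc]
        refine le_mul_of_one_le_right (by linarith) ?_
        rw [hδ, mul_div_assoc', le_div_iff₀ huc]
        have : 1 ≤ Real.pi / 2 * W := by nlinarith
        nlinarith
      gcongr)
    hq.ge
  refine ⟨ρ, hρ, hρT.le.trans ?_⟩
  -- 1/(u - c) = 1/u + c/(u(u - c)). With W ≤ 3 and u ≤ 2(u - c), the second term is at most 3πc/u²,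
  -- which is the constant in the statement.
  have hδu : δ = Real.pi / 2 * W / u + Real.pi / 2 * W * c / (u * (u - c)) := by
    rw [hδ]; field_simp; ring
  rw [hδu]
  refine add_le_add le_rfl ?_
  rw [div_le_div_iff₀ (by positivity) (by positivity)]
  have h1 : u ≤ 2 * (u - c) := by linarith
  have h2 : Real.pi / 2 * W * c * u ^ 2 ≤ Real.pi / 2 * 3 * c * (u * (2 * (u - c))) := by
    rw [sq]; gcongr
  refine h2.trans (le_of_eq ?_)
  ring
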